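/- Fix $\beta>0$. For real $f\in C_c^\infty(\mathbb R)$ put $\hat f(p)=\int_{\mathbb R}e^{ixp}f(x)\,dx$. Let $\mathcal K=\mathcal K_\beta$ be the real Hilbert space obtained by completing $C_c^\infty(\mathbb R)$ (real-valued functions) with respect to the thermal form $$\tau_\beta(f,g)=\operatorname{Re}\lim_{\varepsilon\to0^+}\Big(-\pi\int_{\mathbb R^2}\frac{f(x)g(y)}{\beta^2\sinh^2\!\big(\tfrac{\pi}{\beta}(x-y)-i\varepsilon\big)}\,dx\,dy\Big)=\frac1\pi\operatorname{Re}\int_0^\infty\overline{\hat f(p)}\,\hat g(p)\,p\coth\!\big(\tfrac{\beta p}{2}\big)\,dp ;$$ through $f\mapsto\hat f$ it is $L^2\big((0,\infty),\tfrac1\pi p\coth(\tfrac{\beta p}{2})\,dp;\mathbb C\big)$, regarded as a real Hilbert space. Let $\sigma(f,g)=\int_{\mathbb R} f(x)g'(x)\,dx$, let $D$ be the bounded operator on $\mathcal K$ with $\sigma(f,g)=\tau_\beta(f,Dg)$, which is multiplication by $-i\tanh(\beta p/2)$, and let $D=C|D|$ be its polar decomposition, so that $C$ is multiplication by $-i$.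 On $\mathcal K^\oplus=\mathcal K\oplus\mathcal K$ with the form $\tau^\oplus=\tau_\beta\oplus\tau_\beta$ consider the complex structure $$i^\oplus=\begin{pmatrix}-D& C\sqrt{1+D^2}\\ C\sqrt{1+D^2}&D\end{pmatrix},$$ and let $\mathcal H^\oplus$ be the complex Hilbert space $(\mathcal K^\oplus,i^\oplus)$ with inner product $\langle u,v\rangle^\oplus=\tau^\oplus(u,v)+i\sigma^\oplus(u,v)$, where $\sigma^\oplus(u,v)=\tau^\oplus(u,-i^\oplus v)$ (the purification of the thermal state of the chiral current at inverse temperature $\beta$). Let $a<b$ be real numbers, $I=(a,b)$, let $H(I)\subset\mathcal K$ be the closure of the real test functions with compact support in $I$, and identify $H(I)$ with the real subspace $H(I)\oplus0$ of $\mathcal H^\oplus$. Then $H(I)$ is a standard and factorial subspace of $\mathcal H^\oplus$, that is: 1. $H(I)$ is a closed real subspace which is cyclic, $\overline{H(I)+i^\oplus H(I)}=\mathcal H^\oplus$, and separating, $H(I)\cap i^\oplus H(I)=\{0\}$; 2. $H(I)\cap H(I)'=\{0\}$, where $H(I)'=\{u\in\mathcal H^\oplus:\sigma^\oplus(u,v)=0\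 \text{for all}\ v\in H(I)\}$ is the symplectic complement. -/

import Mathlib

noncomputable section

namespace ThermalCurrent

open MeasureTheory Set Complex Filter Topology
open scoped ENNReal ContDiff

/-- Real test functions on `ℝ` with support in `U`: smooth, with compact support contained
in `U`. -/
def testFunctions (U : Set ℝ) : Submodule ℝ (ℝ → ℝ) where
  carrier := {f | ContDiff ℝ ∞ f ∧ HasCompactSupport f ∧ tsupport f ⊆ U}
  zero_mem' := ⟨contDiff_const, HasCompactSupport.zero, by simp [tsupport]⟩
  add_mem' := fun {f g} hf hg =>
    ⟨hf.1.add hg.1, hf.2.1.add hg.2.1,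
      (tsupport_add f g).trans (union_subset hf.2.2 hg.2.2)⟩
  smul_mem' := fun c f hf =>
    ⟨hf.1.const_smul c, hf.2.1.smul_left (f := fun _ => c),
      (tsupport_smul_subset_right (fun _ => c) f).trans hf.2.2⟩

/-- The Fourier transform `f̂(p) = ∫ e^{ixp} f(x) dx`. -/
def fourierHat (f : ℝ → ℝ) (p : ℝ) : ℂ := ∫ x : ℝ, Complex.exp (I * x * p) * (f x : ℂ)

/-- The weight `(1/π) p coth(β p / 2)` of the thermal form in momentum space. -/
def thermalWeight (β p : ℝ) : ℝ :=
  p * (Real.cosh (β * p / 2) / Real.sinh (β * p / 2)) / Real.pi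

/-- The measure `(1/π) p coth(β p / 2) dp` on the half-line `(0, ∞)`. -/
def thermalMeasure (β : ℝ) : Measure ℝ :=
  (volume.restrict (Ioi (0 : ℝ))).withDensity (fun p => ENNReal.ofReal (thermalWeight β p))

/-- The real Hilbert space `𝒦`, the completion of the real test functions for the thermal form
`τ_β(f, g) = (1/π) Re ∫₀^∞ conj (f̂ p) (ĝ p) p coth(β p / 2) dp`.
It is a space of complex valued functions of the momentum `p > 0`, used as a real Hilbert space with
inner product `Re ∫ conj (u p) (v p)` against `thermalMeasure`. -/
abbrev OneParticle (β : ℝ) : Type := Lp ℂ 2 (thermalMeasure β)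

lemma measurable_thermalWeight (β : ℝ) : Measurable (thermalWeight β) := by
  unfold thermalWeight
  have h1 : Measurable fun p : ℝ => Real.cosh (β * p / 2) :=
    Real.measurable_cosh.comp (by fun_prop)
  have h2 : Measurable fun p : ℝ => Real.sinh (β * p / 2) :=
    Real.measurable_sinh.comp (by fun_prop)
  exact ((measurable_id.mul (h1.div h2)).div_const _)

lemma thermalWeight_le (β p : ℝ) (hp : 0 < p) : thermalWeight β p ≤ (p + 2 / |β|) / Real.pi := by
  unfold thermalWeight
  apply div_le_div_of_nonneg_right _ Real.pi_pos.le
  rcases le_or_gt β 0 with hβ | hβ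
  · have h1 : Real.sinh (β * p / 2) ≤ 0 := by
      apply Real.sinh_nonpos_iff.2
      nlinarith
    have h2 : Real.cosh (β * p / 2) / Real.sinh (β * p / 2) ≤ 0 :=
      div_nonpos_of_nonneg_of_nonpos (Real.cosh_pos _).le h1
    have h3 : 0 ≤ 2 / |β| := by positivity
    nlinarith
  · rw [abs_of_pos hβ]
    have hy : 0 < β * p / 2 := by positivity
    have hs : 0 < Real.sinh (β * p / 2) := Real.sinh_pos_iff.2 hy
    have hys : β * p / 2 ≤ Real.sinh (β * p / 2) := Real.self_le_sinh_iff.2 hy.le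
    have hc : Real.cosh (β * p / 2) ≤ 1 + Real.sinh (β * p / 2) := by
      have := Real.cosh_sub_sinh (β * p / 2)
      have h2 : Real.exp (-(β * p / 2)) ≤ 1 := Real.exp_le_one_iff.2 (by linarith)
      linarith
    rw [← mul_div_assoc, div_le_iff₀ hs]
    have h4 : 1 * p ≤ 2 / β * Real.sinh (β * p / 2) := by
      rw [div_mul_eq_mul_div, le_div_iff₀ hβ]; linarith
    nlinarith

instance instTemperate (β : ℝ) : (thermalMeasure β).HasTemperateGrowth := by
  refine ⟨⟨3, ?_⟩⟩
  unfold thermalMeasure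
  rw [integrable_withDensity_iff (measurable_thermalWeight β).ennreal_ofReal (by simp)]
  set C : ℝ := 1 + 2 / |β|
  have hC : 0 ≤ 2 / |β| := by positivity
  have hI : Integrable (fun x : ℝ => C * (1 + ‖x‖) ^ (-(2 : ℝ))) (volume.restrict (Ioi 0)) :=
    ((integrable_one_add_norm (E := ℝ) (r := 2) (by simp)).const_mul C).restrict
  refine hI.mono' ?_ ?_
  · refine Measurable.aestronglyMeasurable ?_
    exact (by fun_prop : Measurable fun x : ℝ => (1 + ‖x‖) ^ (-((3 : ℕ) : ℝ))).mul
      (measurable_thermalWeight β).ennreal_ofReal.ennreal_toReal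
  · filter_upwards [ae_restrict_mem measurableSet_Ioi] with x hx
    have hx : 0 < x := hx
    have hw : (ENNReal.ofReal (thermalWeight β x)).toReal ≤ C * (1 + ‖x‖) := by
      rw [ENNReal.toReal_ofReal']
      apply max_le
      · refine (thermalWeight_le β x hx).trans ?_
        rw [Real.norm_of_nonneg hx.le]
        have h3 : (1 : ℝ) ≤ Real.pi := by linarith [Real.pi_gt_three]
        refine (div_le_self (by positivity) h3).trans ?_
        simp only [C]
        nlinarith
      · positivity
    rw [norm_mul, Real.norm_of_nonneg ENNReal.toReal_nonneg, Real.norm_of_nonneg (by positivity)]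
    have hpos : (0 : ℝ) < 1 + ‖x‖ := by positivity
    calc (1 + ‖x‖) ^ (-((3 : ℕ) : ℝ)) * (ENNReal.ofReal (thermalWeight β x)).toReal
        ≤ (1 + ‖x‖) ^ (-((3 : ℕ) : ℝ)) * (C * (1 + ‖x‖)) := by gcongr
      _ = C * ((1 + ‖x‖) ^ (-((3 : ℕ) : ℝ)) * (1 + ‖x‖) ^ (1 : ℝ)) := by
          rw [Real.rpow_one]; ring
      _ = C * (1 + ‖x‖) ^ (-(2 : ℝ)) := by
          rw [← Real.rpow_add hpos]; norm_num

/-- The Schwartz function attached to a test function. -/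
def toSchwartz {U : Set ℝ} (f : testFunctions U) : SchwartzMap ℝ ℂ :=
  HasCompactSupport.toSchwartzMap (f := fun x => ((f : ℝ → ℝ) x : ℂ))
    (f.2.2.1.comp_left (g := fun r : ℝ => (r : ℂ)) (by simp))
    (Complex.ofRealCLM.contDiff.comp f.2.1)

lemma toSchwartz_apply {U : Set ℝ} (f : testFunctions U) (x : ℝ) :
    toSchwartz f x = ((f : ℝ → ℝ) x : ℂ) := rfl

lemma fourierHat_eq {U : Set ℝ} (f : testFunctions U) (p : ℝ) :
    fourierHat f p = (FourierTransform.fourier (toSchwartz f)) (-(p / (2 * Real.pi))) := by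
  rw [SchwartzMap.fourier_coe, Real.fourier_eq']
  unfold fourierHat
  congr 1
  ext x
  rw [toSchwartz_apply, smul_eq_mul]
  congr 2
  simp only [RCLike.inner_apply, conj_trivial]
  push_cast
  have : (Real.pi : ℂ) ≠ 0 := by exact_mod_cast Real.pi_ne_zero
  field_simp

lemma memLp_fourierHat (β : ℝ) {U : Set ℝ} (f : testFunctions U) :
    MemLp (fourierHat f) 2 (thermalMeasure β) := by
  let e : ℝ ≃L[ℝ] ℝ := ContinuousLinearEquiv.unitsEquivAut ℝ
    (Units.mk0 (-(1 / (2 * Real.pi))) (by simp [Real.pi_ne_zero]))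
  have h := (SchwartzMap.compCLMOfContinuousLinearEquiv ℝ e
    (FourierTransform.fourier (toSchwartz f))).memLp 2 (thermalMeasure β)
  convert h using 1
  ext p
  rw [fourierHat_eq]
  simp only [SchwartzMap.compCLMOfContinuousLinearEquiv_apply, Function.comp]
  congr 1
  simp [e, ContinuousLinearEquiv.unitsEquivAut]
  ring

/-- The embedding of test functions in `𝒦`: `f ↦ f̂`. -/
def embed (β : ℝ) (U : Set ℝ) : testFunctions U →ₗ[ℝ] OneParticle β where
  toFun f := (memLp_fourierHat β f).toLp (fourierHat f)
  map_add' f g := by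
    rw [← MemLp.toLp_add]
    refine MemLp.toLp_congr _ _ (ae_of_all _ fun p => ?_)
    simp only [Pi.add_apply, fourierHat_eq]
    have : toSchwartz (f + g) = toSchwartz f + toSchwartz g := by
      ext x; simp [toSchwartz_apply]
    rw [this, FourierTransform.fourier_add]; rfl
  map_smul' c f := by
    rw [RingHom.id_apply, ← MemLp.toLp_const_smul]
    refine MemLp.toLp_congr _ _ (ae_of_all _ fun p => ?_)
    simp only [Pi.smul_apply, fourierHat_eq]
    have : toSchwartz (c • f) = c • toSchwartz f := by
      ext x; simp [toSchwartz_apply]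
    rw [this, FourierTransform.fourier_smul]; rfl

/-- Multiplication by a bounded measurable function `m` of the momentum. -/
def mulOp (β : ℝ) (m : ℝ → ℂ) (hm : MemLp m ∞ (thermalMeasure β)) :
    OneParticle β →L[ℝ] OneParticle β :=
  (ContinuousLinearMap.mul ℝ ℂ).holderL (thermalMeasure β) ∞ 2 2 (hm.toLp m)

lemma coeFn_mulOp (β : ℝ) (m : ℝ → ℂ) (hm : MemLp m ∞ (thermalMeasure β))
    (u : OneParticle β) :
    mulOp β m hm u =ᵐ[thermalMeasure β] fun p => m p * u p := by
  have h := (ContinuousLinearMap.mul ℝ ℂ).coeFn_holder (r := 2) (hm.toLp m) u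
  filter_upwards [h, hm.coeFn_toLp] with p hp hq
  have h3 : mulOp β m hm u p
      = (ContinuousLinearMap.mul ℝ ℂ).holder 2 (hm.toLp m) u p := rfl
  rw [h3, hp, hq]; rfl

/-- The function `tanh (β p / 2)`. -/
def thermalTanh (β p : ℝ) : ℝ := Real.tanh (β * p / 2)

/-- The function `1 / cosh (β p / 2)`. -/
def thermalSech (β p : ℝ) : ℝ := 1 / Real.cosh (β * p / 2)

lemma thermalTanh_sq_add (β p : ℝ) : thermalTanh β p ^ 2 + thermalSech β p ^ 2 = 1 := by
  unfold thermalTanh thermalSech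
  rw [Real.tanh_eq_sinh_div_cosh]
  have := Real.cosh_pos (β * p / 2)
  have h := Real.cosh_sq (β * p / 2)
  field_simp
  linarith

lemma measurable_thermalTanh (β : ℝ) : Measurable (thermalTanh β) := by
  unfold thermalTanh
  simp only [Real.tanh_eq_sinh_div_cosh]
  exact (Real.measurable_sinh.comp (by fun_prop)).div (Real.measurable_cosh.comp (by fun_prop))

lemma measurable_thermalSech (β : ℝ) : Measurable (thermalSech β) := by
  unfold thermalSech
  exact measurable_const.div (Real.measurable_cosh.comp (by fun_prop))

lemma memLp_const_I (β : ℝ) : MemLp (fun _ : ℝ => (-I : ℂ)) ∞ (thermalMeasure β) :=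
  memLp_top_of_bound aestronglyMeasurable_const 1 (ae_of_all _ fun p => by simp)

lemma memLp_tanh (β : ℝ) : MemLp (fun p : ℝ => (thermalTanh β p : ℂ)) ∞ (thermalMeasure β) := by
  refine memLp_top_of_bound
    (measurable_ofReal.comp (measurable_thermalTanh β)).aestronglyMeasurable 1
    (ae_of_all _ fun p => ?_)
  rw [norm_real]
  refine abs_le_one_iff_mul_self_le_one.2 ?_
  nlinarith [thermalTanh_sq_add β p, sq_nonneg (thermalSech β p)]

lemma memLp_sech (β : ℝ) : MemLp (fun p : ℝ => (thermalSech β p : ℂ)) ∞ (thermalMeasure β) := by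
  refine memLp_top_of_bound
    (measurable_ofReal.comp (measurable_thermalSech β)).aestronglyMeasurable 1
    (ae_of_all _ fun p => ?_)
  rw [norm_real]
  refine abs_le_one_iff_mul_self_le_one.2 ?_
  nlinarith [thermalTanh_sq_add β p, sq_nonneg (thermalTanh β p)]

/-- The phase `C` in the polar decomposition `D = C |D|`: multiplication by `-i`. -/
def opC (β : ℝ) : OneParticle β →L[ℝ] OneParticle β := mulOp β _ (memLp_const_I β)

/-- The modulus `|D|`: multiplication by `tanh (β p / 2)`, which is positive. -/
def opAbsD (β : ℝ) : OneParticle β →L[ℝ] OneParticle β := mulOp β _ (memLp_tanh β)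

/-- The operator `D = C |D|` with `σ(f, g) = τ_β(f, D g)`: multiplication by
`-i tanh (β p / 2)`. -/
def opD (β : ℝ) : OneParticle β →L[ℝ] OneParticle β := (opC β).comp (opAbsD β)

/-- The positive square root `√(1 + D²)`: multiplication by `1 / cosh (β p / 2)`. -/
def opR (β : ℝ) : OneParticle β →L[ℝ] OneParticle β := mulOp β _ (memLp_sech β)

lemma opC_opC (β : ℝ) (u : OneParticle β) : opC β (opC β u) = -u := by
  apply Lp.ext
  filter_upwards [coeFn_mulOp β _ (memLp_const_I β) (opC β u),
    coeFn_mulOp β _ (memLp_const_I β) u, Lp.coeFn_neg u] with p h1 h2 h3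
  rw [h3, Pi.neg_apply]
  refine h1.trans ?_
  change -I * (mulOp β _ (memLp_const_I β) u) p = _
  rw [h2, ← mul_assoc]; simp

lemma mulOp_comm (β : ℝ) (m n : ℝ → ℂ) (hm : MemLp m ∞ (thermalMeasure β))
    (hn : MemLp n ∞ (thermalMeasure β)) (u : OneParticle β) :
    mulOp β m hm (mulOp β n hn u) = mulOp β n hn (mulOp β m hm u) := by
  apply Lp.ext
  filter_upwards [coeFn_mulOp β m hm (mulOp β n hn u), coeFn_mulOp β n hn u,
    coeFn_mulOp β n hn (mulOp β m hm u), coeFn_mulOp β m hm u] with p h1 h2 h3 h4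
  rw [h1, h2, h3, h4]; ring

lemma opR_opC (β : ℝ) (u : OneParticle β) : opR β (opC β u) = opC β (opR β u) :=
  mulOp_comm ..

lemma opAbsD_opC (β : ℝ) (u : OneParticle β) : opAbsD β (opC β u) = opC β (opAbsD β u) :=
  mulOp_comm ..

lemma opR_opAbsD (β : ℝ) (u : OneParticle β) : opR β (opAbsD β u) = opAbsD β (opR β u) :=
  mulOp_comm ..

lemma absD_sq_add_R_sq (β : ℝ) (u : OneParticle β) :
    opAbsD β (opAbsD β u) + opR β (opR β u) = u := by
  apply Lp.ext
  filter_upwards [Lp.coeFn_add (opAbsD β (opAbsD β u)) (opR β (opR β u)),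
    coeFn_mulOp β _ (memLp_tanh β) (opAbsD β u), coeFn_mulOp β _ (memLp_tanh β) u,
    coeFn_mulOp β _ (memLp_sech β) (opR β u), coeFn_mulOp β _ (memLp_sech β) u]
    with p h0 h1 h2 h3 h4
  rw [h0, Pi.add_apply]
  change (mulOp β _ (memLp_tanh β) (opAbsD β u)) p + (mulOp β _ (memLp_sech β) (opR β u)) p = _
  rw [h1, h3]
  change _ * (mulOp β _ (memLp_tanh β) u) p + _ * (mulOp β _ (memLp_sech β) u) p = _
  rw [h2, h4]
  have h : (thermalTanh β p : ℂ) ^ 2 + (thermalSech β p : ℂ) ^ 2 = 1 := by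
    exact_mod_cast congrArg (fun r : ℝ => (r : ℂ)) (thermalTanh_sq_add β p)
  linear_combination (u p) * h

/-- `√(1 + D²)` squares to `1 + D²`. -/
lemma opR_opR (β : ℝ) (u : OneParticle β) : opR β (opR β u) = u + opD β (opD β u) := by
  have h := absD_sq_add_R_sq β u
  simp only [opD, ContinuousLinearMap.comp_apply, opAbsD_opC, opC_opC]
  rw [← sub_eq_add_neg, eq_sub_iff_add_eq, add_comm]
  exact h

lemma inner_mulOp_real (β : ℝ) (m : ℝ → ℝ)
    (hm : MemLp (fun p => (m p : ℂ)) ∞ (thermalMeasure β)) (u v : OneParticle β) :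
    inner ℝ (mulOp β _ hm u) v = inner ℝ u (mulOp β _ hm v) := by
  rw [L2.inner_def, L2.inner_def]
  apply integral_congr_ae
  filter_upwards [coeFn_mulOp β _ hm u, coeFn_mulOp β _ hm v] with p h1 h2
  rw [h1, h2, Complex.inner, Complex.inner]
  simp
  ring

lemma inner_opC (β : ℝ) (u v : OneParticle β) :
    inner ℝ (opC β u) v = - inner ℝ u (opC β v) := by
  rw [L2.inner_def, L2.inner_def, ← integral_neg]
  apply integral_congr_ae
  filter_upwards [coeFn_mulOp β _ (memLp_const_I β) u, coeFn_mulOp β _ (memLp_const_I β) v]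
    with p h1 h2
  change inner ℝ ((mulOp β _ (memLp_const_I β) u) p) (v p)
    = - inner ℝ (u p) ((mulOp β _ (memLp_const_I β) v) p)
  rw [h1, h2, Complex.inner, Complex.inner]
  simp
  ring

lemma inner_opD (β : ℝ) (u v : OneParticle β) :
    inner ℝ (opD β u) v = - inner ℝ u (opD β v) := by
  simp only [opD, ContinuousLinearMap.comp_apply]
  rw [inner_opC, ← opAbsD_opC]
  exact congrArg _ (inner_mulOp_real β _ (memLp_tanh β) u _)

lemma inner_opCR (β : ℝ) (u v : OneParticle β) :
    inner ℝ (opC β (opR β u)) v = - inner ℝ u (opC β (opR β v)) := by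
  rw [inner_opC, ← opR_opC]
  exact congrArg _ (inner_mulOp_real β _ (memLp_sech β) u _)

/-- The real Hilbert space `𝒦^⊕ = 𝒦 ⊕ 𝒦` with the form `τ^⊕ = τ_β ⊕ τ_β`. -/
abbrev Doubled (β : ℝ) : Type := WithLp 2 (OneParticle β × OneParticle β)

/-- The complex structure on `𝒦 ⊕ 𝒦`,
`i^⊕ (x, y) = (-D x + C √(1 + D²) y, C √(1 + D²) x + D y)`. -/
def iPlus (β : ℝ) : Doubled β →ₗ[ℝ] Doubled β where
  toFun v := WithLp.toLp 2
    (-(opD β v.fst) + opC β (opR β v.snd), opC β (opR β v.fst) + opD β v.snd)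
  map_add' v w := by
    refine WithLp.ofLp_injective 2 (Prod.ext ?_ ?_) <;> simp <;> abel
  map_smul' c v := by
    refine WithLp.ofLp_injective 2 (Prod.ext ?_ ?_) <;> simp

@[simp] lemma iPlus_fst (β : ℝ) (v : Doubled β) :
    (iPlus β v).fst = -(opD β v.fst) + opC β (opR β v.snd) := rfl

@[simp] lemma iPlus_snd (β : ℝ) (v : Doubled β) :
    (iPlus β v).snd = opC β (opR β v.fst) + opD β v.snd := rfl

lemma iPlus_iPlus (β : ℝ) (v : Doubled β) : iPlus β (iPlus β v) = -v := by
  have hD : ∀ u : OneParticle β, opD β (opD β u) = opR β (opR β u) - u := fun u => by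
    rw [opR_opR]; abel
  have hCR : ∀ u : OneParticle β, opC β (opR β (opC β (opR β u))) = -(opR β (opR β u)) :=
    fun u => by rw [opR_opC, opC_opC]
  have hc : ∀ u : OneParticle β, opC β (opR β (opD β u)) = opD β (opC β (opR β u)) := fun u => by
    simp only [opD, ContinuousLinearMap.comp_apply, opR_opC, opR_opAbsD, opAbsD_opC]
  refine WithLp.ofLp_injective 2 (Prod.ext ?_ ?_)
  · change (iPlus β (iPlus β v)).fst = -v.fst
    simp only [iPlus_fst, iPlus_snd, map_add, map_neg, hD, hCR, hc]
    abel
  · change (iPlus β (iPlus β v)).snd = -v.snd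
    simp only [iPlus_fst, iPlus_snd, map_add, map_neg, hD, hCR, hc]
    abel

lemma inner_iPlus (β : ℝ) (v w : Doubled β) :
    inner ℝ (iPlus β v) w = - inner ℝ v (iPlus β w) := by
  rw [WithLp.prod_inner_apply, WithLp.prod_inner_apply]
  change inner ℝ (iPlus β v).fst w.fst + inner ℝ (iPlus β v).snd w.snd
    = -(inner ℝ v.fst (iPlus β w).fst + inner ℝ v.snd (iPlus β w).snd)
  simp only [iPlus_fst, iPlus_snd, inner_add_left, inner_add_right,
    inner_neg_left, inner_neg_right, inner_opD, inner_opCR]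
  ring

/-- The purified one-particle space `ℋ^⊕`: the real Hilbert space `𝒦 ⊕ 𝒦` made a complex Hilbert
space by the complex structure `i^⊕`. -/
def Purified (β : ℝ) : Type := Doubled β

namespace Purified

variable {β : ℝ}

instance : NormedAddCommGroup (Purified β) := inferInstanceAs (NormedAddCommGroup (Doubled β))

instance : CompleteSpace (Purified β) := inferInstanceAs (CompleteSpace (Doubled β))

/-- The vector `x ⊕ y` of `ℋ^⊕`. -/
def mk (x y : OneParticle β) : Purified β := (WithLp.toLp 2 (x, y) : Doubled β)

/-- The underlying vector of the real Hilbert space `𝒦 ⊕ 𝒦`. -/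
def toDoubled (v : Purified β) : Doubled β := v

/-- `(a + b i) v = a v + b i^⊕ v`. -/
instance : Module ℂ (Purified β) where
  smul z v := (z.re • toDoubled v + z.im • iPlus β (toDoubled v) : Doubled β)
  one_smul v := by
    change ((1 : ℂ).re • toDoubled v + (1 : ℂ).im • iPlus β (toDoubled v) : Doubled β) = toDoubled v
    rw [one_re, one_im, one_smul, zero_smul, add_zero]
  mul_smul z w v := by
    change ((z * w).re • toDoubled v + (z * w).im • iPlus β (toDoubled v) : Doubled β)
      = (z.re • (w.re • toDoubled v + w.im • iPlus β (toDoubled v))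
        + z.im • iPlus β (w.re • toDoubled v + w.im • iPlus β (toDoubled v)) : Doubled β)
    simp only [map_add, map_smul, iPlus_iPlus, mul_re, mul_im, sub_smul, add_smul, smul_add,
      smul_smul, smul_neg]
    abel
  smul_zero z := by
    change (z.re • (0 : Doubled β) + z.im • iPlus β (0 : Doubled β) : Doubled β) = 0
    simp
  smul_add z v w := by
    change (z.re • (toDoubled v + toDoubled w) + z.im • iPlus β (toDoubled v + toDoubled w)
      : Doubled β) = (z.re • toDoubled v + z.im • iPlus β (toDoubled v))
        + (z.re • toDoubled w + z.im • iPlus β (toDoubled w))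
    simp only [map_add, smul_add]
    abel
  add_smul z w v := by
    change ((z + w).re • toDoubled v + (z + w).im • iPlus β (toDoubled v) : Doubled β)
      = (z.re • toDoubled v + z.im • iPlus β (toDoubled v))
        + (w.re • toDoubled v + w.im • iPlus β (toDoubled v))
    simp only [add_re, add_im, add_smul]
    abel
  zero_smul v := by
    change ((0 : ℂ).re • toDoubled v + (0 : ℂ).im • iPlus β (toDoubled v) : Doubled β) = 0
    simp

lemma smul_def (z : ℂ) (v : Purified β) :
    toDoubled (z • v) = z.re • toDoubled v + z.im • iPlus β (toDoubled v) := rfl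

lemma real_smul_def (c : ℝ) (v : Purified β) : toDoubled (c • v) = c • toDoubled v := by
  change toDoubled ((c : ℂ) • v) = _
  rw [smul_def]; simp

lemma inner_iPlus_self (v : Doubled β) : inner ℝ v (iPlus β v) = 0 := by
  have h := inner_iPlus β v v
  rw [real_inner_comm] at h
  linarith

lemma norm_iPlus (v : Doubled β) : ‖iPlus β v‖ = ‖v‖ := by
  have h : ‖iPlus β v‖ ^ 2 = ‖v‖ ^ 2 := by
    rw [← real_inner_self_eq_norm_sq, ← real_inner_self_eq_norm_sq, inner_iPlus, iPlus_iPlus,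
      inner_neg_right, neg_neg]
  exact (sq_eq_sq₀ (norm_nonneg _) (norm_nonneg _)).1 h

/-- The complex inner product `⟨v, w⟩^⊕ = τ^⊕(v, w) + i σ^⊕(v, w)` with
`σ^⊕(v, w) = τ^⊕(v, -i^⊕ w)`. -/
instance : InnerProductSpace ℂ (Purified β) where
  norm_smul_le z v := by
    have h : ‖(z.re • toDoubled v + z.im • iPlus β (toDoubled v) : Doubled β)‖ ^ 2
        = (‖z‖ * ‖toDoubled v‖) ^ 2 := by
      rw [norm_add_sq_real, norm_smul, norm_smul, norm_iPlus, inner_smul_left, inner_smul_right,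
        inner_iPlus_self, mul_pow, mul_pow, mul_pow ‖z‖, Complex.sq_norm, Complex.normSq_apply,
        Real.norm_eq_abs, Real.norm_eq_abs, sq_abs, sq_abs]
      ring
    exact ((sq_eq_sq₀ (norm_nonneg _) (by positivity)).1 h).le
  inner v w := ⟨inner ℝ (toDoubled v) (toDoubled w),
    inner ℝ (toDoubled v) (-(iPlus β (toDoubled w)))⟩
  norm_sq_eq_re_inner v := (real_inner_self_eq_norm_sq (toDoubled v)).symm
  conj_inner_symm v w := by
    apply Complex.ext
    · exact real_inner_comm _ _
    · change -(inner ℝ (toDoubled w) (-(iPlus β (toDoubled v))))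
        = inner ℝ (toDoubled v) (-(iPlus β (toDoubled w)))
      rw [inner_neg_right, inner_neg_right, real_inner_comm, inner_iPlus, neg_neg]
  add_left u v w := by
    apply Complex.ext
    · exact inner_add_left _ _ _
    · exact inner_add_left _ _ _
  smul_left v w z := by
    apply Complex.ext
    · change inner ℝ (z.re • toDoubled v + z.im • iPlus β (toDoubled v)) (toDoubled w)
        = (starRingEnd ℂ z).re * inner ℝ (toDoubled v) (toDoubled w)
          - (starRingEnd ℂ z).im * inner ℝ (toDoubled v) (-(iPlus β (toDoubled w)))
      rw [inner_add_left, inner_smul_left, inner_smul_left, inner_iPlus, inner_neg_right]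
      simp
    · change inner ℝ (z.re • toDoubled v + z.im • iPlus β (toDoubled v))
          (-(iPlus β (toDoubled w)))
        = (starRingEnd ℂ z).re * inner ℝ (toDoubled v) (-(iPlus β (toDoubled w)))
          + (starRingEnd ℂ z).im * inner ℝ (toDoubled v) (toDoubled w)
      rw [inner_add_left, inner_smul_left, inner_smul_left, inner_iPlus, inner_neg_right, map_neg,
        iPlus_iPlus, neg_neg, conj_re, conj_im]
      simp only [conj_trivial]
      ring

lemma inner_def (v w : Purified β) :
    inner ℂ v w = ⟨inner ℝ (toDoubled v) (toDoubled w),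
      inner ℝ (toDoubled v) (-(iPlus β (toDoubled w)))⟩ := rfl

end Purified

/-- The closed real subspace `H(U)` of `𝒦`: the closure of the test functions supported in `U`. -/
def localSpace (β : ℝ) (U : Set ℝ) : Submodule ℝ (OneParticle β) :=
  (LinearMap.range (embed β U)).topologicalClosure

/-- The closed real subspace `H(U) ⊕ 0` of the purified space `ℋ^⊕`. -/
def localSubspace (β : ℝ) (U : Set ℝ) : ClosedSubmodule ℝ (Purified β) where
  carrier := {v | ∃ x ∈ localSpace β U, v = Purified.mk x 0}
  zero_mem' := ⟨0, zero_mem _, rfl⟩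
  add_mem' := by
    rintro _ _ ⟨x, hx, rfl⟩ ⟨y, hy, rfl⟩
    refine ⟨x + y, add_mem hx hy, ?_⟩
    refine WithLp.ofLp_injective 2 (Prod.ext rfl ?_)
    exact add_zero (0 : OneParticle β)
  smul_mem' := by
    rintro c _ ⟨x, hx, rfl⟩
    refine ⟨c • x, Submodule.smul_mem _ c hx, ?_⟩
    refine (Purified.real_smul_def c _).trans ?_
    refine WithLp.ofLp_injective 2 (Prod.ext rfl ?_)
    exact smul_zero (A := OneParticle β) c
  isClosed' := by
    have h : {v : Purified β | ∃ x ∈ localSpace β U, v = Purified.mk x 0}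
        = (fun v : Doubled β => v.fst) ⁻¹' (localSpace β U : Set (OneParticle β))
          ∩ (fun v : Doubled β => v.snd) ⁻¹' {0} := by
      ext v
      constructor
      · rintro ⟨x, hx, rfl⟩
        exact ⟨hx, rfl⟩
      · rintro ⟨h1, h2⟩
        exact ⟨_, h1, WithLp.ofLp_injective 2 (Prod.ext rfl h2)⟩
    change IsClosed {v : Purified β | ∃ x ∈ localSpace β U, v = Purified.mk x 0}
    rw [h]
    exact ((Submodule.isClosed_topologicalClosure _).preimage
      (WithLp.continuous_fst 2 _ _)).inter (isClosed_singleton.preimage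
      (WithLp.continuous_snd 2 _ _))

/-! Consistency of the momentum-space definitions with the position-space data: the inner product
on `𝒦 ⊕ 0` is the thermal two-point function, its imaginary part is `σ(f, g) = ∫ f g'`, and the
test functions are dense in `𝒦`. -/

lemma integral_mul_exp_Ioi {c : ℂ} (hc : 0 < c.re) :
    IntegrableOn (fun p : ℝ => (p : ℂ) * Complex.exp (-(p * c))) (Ioi 0) ∧
    ∫ p in Ioi (0 : ℝ), (p : ℂ) * Complex.exp (-(p * c)) = 1 / c ^ 2 := by
  have hc0 : c ≠ 0 := by rintro rfl; simp at hc
  have hnorm : ∀ p : ℝ, ‖Complex.exp (-(p * c))‖ = Real.exp (-(c.re * p)) := fun p => by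
    rw [Complex.norm_exp]; simp [mul_comm]
  have hint : IntegrableOn (fun p : ℝ => (p : ℂ) * Complex.exp (-(p * c))) (Ioi 0) := by
    have h := integrableOn_rpow_mul_exp_neg_mul_rpow (p := 1) (s := 1) (by norm_num)
      (by norm_num) hc
    refine h.mono' (by fun_prop) ?_
    filter_upwards [ae_restrict_mem measurableSet_Ioi] with p hp
    have hp : 0 < p := hp
    rw [norm_mul, hnorm, norm_real, Real.norm_of_nonneg hp.le]
    simp
  refine ⟨hint, ?_⟩
  have hderiv : ∀ p ∈ Ici (0 : ℝ), HasDerivAt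
      (fun p : ℝ => -((p : ℂ) / c + 1 / c ^ 2) * Complex.exp (-(p * c)))
      ((p : ℂ) * Complex.exp (-(p * c))) p := by
    intro p _
    have h1 : HasDerivAt (fun p : ℝ => (p : ℂ)) 1 p := Complex.ofRealCLM.hasDerivAt
    have h2 := ((h1.div_const c).add_const (1 / c ^ 2)).neg
    have h3 := ((h1.mul_const c).neg).cexp
    refine (h2.mul h3).congr_deriv ?_
    simp only [Pi.neg_apply]
    field_simp
    ring
  have hlim : Tendsto (fun p : ℝ => -((p : ℂ) / c + 1 / c ^ 2) * Complex.exp (-(p * c))) atTop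
      (𝓝 0) := by
    rw [tendsto_zero_iff_norm_tendsto_zero]
    have e1 : Tendsto (fun p : ℝ => (p / ‖c‖ + 1 / ‖c‖ ^ 2) * Real.exp (-(c.re * p))) atTop
        (𝓝 0) := by
      have a1 := (Real.tendsto_pow_mul_exp_neg_atTop_nhds_zero 1).comp
        (tendsto_id.const_mul_atTop hc)
      have a0 := (Real.tendsto_pow_mul_exp_neg_atTop_nhds_zero 0).comp
        (tendsto_id.const_mul_atTop hc)
      have := (a1.const_mul (1 / (‖c‖ * c.re))).add (a0.const_mul (1 / ‖c‖ ^ 2))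
      simp only [mul_zero, add_zero] at this
      refine this.congr fun p => ?_
      have : ‖c‖ ≠ 0 := by simpa
      simp only [Function.comp, id]
      field_simp
    refine squeeze_zero' (Eventually.of_forall fun _ => norm_nonneg _) ?_ e1
    filter_upwards [eventually_ge_atTop 0] with p hp
    rw [norm_mul, hnorm, norm_neg]
    gcongr
    refine (norm_add_le _ _).trans_eq ?_
    simp [abs_of_nonneg hp]
  have := integral_Ioi_of_hasDerivAt_of_tendsto' hderiv hint hlim
  rw [this]; simp

lemma hasSum_half {β : ℝ} (hβ : 0 < β) {z : ℂ} (hz : 0 < z.re) :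
    HasSum (fun n : ℕ => 1 / (z + n * β) ^ 2)
      (∫ p in Ioi (0 : ℝ), (p : ℂ) * Complex.exp (-(p * z)) / (1 - Real.exp (-(β * p)) : ℝ)) := by
  have hre : ∀ n : ℕ, 0 < (z + n * β).re := fun n => by
    simp only [add_re, mul_re, natCast_re, ofReal_re, natCast_im, ofReal_im]
    have : (0 : ℝ) ≤ n * β := by positivity
    linarith
  have key := hasSum_integral_of_summable_integral_norm (μ := volume.restrict (Ioi (0 : ℝ)))
    (F := fun (n : ℕ) (p : ℝ) => (p : ℂ) * Complex.exp (-(p * (z + n * β))))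
    (fun n => (integral_mul_exp_Ioi (hre n)).1) ?_
  · simp only [(integral_mul_exp_Ioi (hre _)).2] at key
    suffices h : ∫ p in Ioi (0 : ℝ), (p : ℂ) * Complex.exp (-(p * z))
        / (1 - Real.exp (-(β * p)) : ℝ)
        = ∫ p in Ioi (0 : ℝ), ∑' n : ℕ, (p : ℂ) * Complex.exp (-(p * (z + n * β))) by
      rw [h]; exact key
    refine setIntegral_congr_fun measurableSet_Ioi fun p hp => ?_
    have hp : 0 < p := hp
    have hlt : ‖(Real.exp (-(β * p)) : ℂ)‖ < 1 := by
      rw [norm_real, Real.norm_of_nonneg (Real.exp_pos _).le, Real.exp_lt_one_iff]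
      have := mul_pos hβ hp
      linarith
    have hg := (hasSum_geometric_of_norm_lt_one hlt).mul_left ((p : ℂ) * Complex.exp (-(p * z)))
    rw [ofReal_sub, ofReal_one, div_eq_mul_inv, ← hg.tsum_eq]
    congr 1
    ext n
    rw [mul_assoc, ofReal_exp, ← Complex.exp_nat_mul, ← Complex.exp_add]
    congr 2
    push_cast
    ring
  · have hval : ∀ n : ℕ, ∫ p in Ioi (0 : ℝ), ‖(p : ℂ) * Complex.exp (-(p * (z + n * β)))‖
        = 1 / (z.re + n * β) ^ 2 := by
      intro n
      have h := (integral_mul_exp_Ioi (c := ((z.re + n * β : ℝ) : ℂ)) (by simpa using hre n)).2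
      apply Complex.ofReal_injective
      rw [← integral_complex_ofReal]
      push_cast at h ⊢
      rw [← h]
      refine setIntegral_congr_fun measurableSet_Ioi fun p hp => ?_
      have hp : 0 < p := hp
      simp only [norm_mul, Complex.norm_exp, norm_real, Real.norm_of_nonneg hp.le]
      push_cast
      simp
    simp only [hval]
    refine Summable.of_nonneg_of_le (fun n => by positivity) (fun n => ?_)
      (((summable_nat_add_iff 1).2 (Real.summable_one_div_nat_pow.2 one_lt_two)).mul_left
        (1 / min z.re β ^ 2))
    have hm : 0 < min z.re β := lt_min hz hβ
    rw [one_div_mul_one_div, ← mul_pow]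
    apply one_div_le_one_div_of_le (by positivity)
    have : min z.re β * ((n + 1 : ℕ) : ℝ) ≤ z.re + n * β := by
      push_cast
      have h1 := min_le_left z.re β
      have h2 : min z.re β * (n : ℝ) ≤ β * n := by gcongr; exact min_le_right _ _
      linarith
    gcongr

lemma tsum_int_inv_sq_aux {w : ℂ} (hw : 0 < w.im) :
    ∑' n : ℤ, 1 / (w + n) ^ 2 = Real.pi ^ 2 / Complex.sin (Real.pi * w) ^ 2 := by
  have h := iteratedDerivWithin_cot_pi_mul_eq_mul_tsum_zpow (k := 1) le_rfl (z := w) hw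
  have hs : Complex.sin (Real.pi * w) ≠ 0 := by
    rw [Complex.sin_ne_zero_iff]
    intro k hk
    have h2 := congrArg Complex.im hk
    simp at h2
    exact hw.ne' h2
  have hd : HasDerivAt (fun x : ℂ => Real.pi * Complex.cot (Real.pi * x))
      (-(Real.pi ^ 2 / Complex.sin (Real.pi * w) ^ 2)) w := by
    have h1 : HasDerivAt (fun x : ℂ => Real.pi * x) (Real.pi : ℂ) w := by
      simpa using (hasDerivAt_id w).const_mul (Real.pi : ℂ)
    have h2 := (h1.ccos.div h1.csin hs).const_mul (Real.pi : ℂ)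
    have h3 := Complex.sin_sq_add_cos_sq (Real.pi * w)
    refine (h2.congr_deriv ?_)
    field_simp
    linear_combination (-1 : ℂ) * h3
  have hopen : IsOpen {z : ℂ | 0 < z.im} := isOpen_lt continuous_const Complex.continuous_im
  rw [iteratedDerivWithin_one, derivWithin_of_isOpen hopen hw, hd.deriv] at h
  have h4 : ∑' n : ℤ, 1 / (w + n) ^ 2 = ∑' n : ℤ, (w + n) ^ (-1 - (1 : ℕ) : ℤ) := by
    congr 1
    ext n
    rw [show (-1 - (1 : ℕ) : ℤ) = -((2 : ℕ) : ℤ) by norm_num, zpow_neg, zpow_natCast, one_div]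
  rw [h4]
  simp at h
  simp
  exact h.symm

lemma tsum_int_inv_sq {w : ℂ} (hw : w.im ≠ 0) :
    ∑' n : ℤ, 1 / (w + n) ^ 2 = Real.pi ^ 2 / Complex.sin (Real.pi * w) ^ 2 := by
  rcases lt_or_gt_of_ne hw with h | h
  · have h1 := tsum_int_inv_sq_aux (w := -w) (by simpa using h)
    rw [mul_neg, Complex.sin_neg, neg_sq] at h1
    rw [← h1, ← (Equiv.neg ℤ).tsum_eq]
    congr 1
    ext n
    simp only [Equiv.neg_apply, Int.cast_neg]
    rw [← neg_sq]
    ring_nf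
  · exact tsum_int_inv_sq_aux h

/-- The weight `p / (1 - e^{-β p})` of the thermal two-point function in momentum space. -/
def boseWeight (β p : ℝ) : ℝ := p / (1 - Real.exp (-(β * p)))

lemma boseWeight_neg {β p : ℝ} :
    boseWeight β (-p) = p * Real.exp (-(β * p)) / (1 - Real.exp (-(β * p))) := by
  unfold boseWeight
  have h : Real.exp (-(β * -p)) = (Real.exp (-(β * p)))⁻¹ := by
    rw [← Real.exp_neg]; congr 1; ring
  rw [h]
  have hx := Real.exp_pos (-(β * p))
  set x := Real.exp (-(β * p))
  by_cases h1 : x = 1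
  · simp [h1]
  · have : 1 - x ≠ 0 := sub_ne_zero.2 (Ne.symm h1)
    have h2 : 1 - x⁻¹ ≠ 0 := by
      rw [sub_ne_zero]; intro h3; exact h1 (by rw [← inv_inv x, ← h3]; simp)
    field_simp
    ring

lemma boseWeight_neg' (β p : ℝ) :
    boseWeight β (-p) = boseWeight β p * Real.exp (-(β * p)) := by
  rw [boseWeight_neg]; unfold boseWeight; ring

lemma boseWeight_pos_bound {β p : ℝ} (hβ : 0 < β) (hp : 0 < p) :
    0 ≤ boseWeight β p ∧ boseWeight β p ≤ p + 1 / β := by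
  have hy : 0 < β * p := mul_pos hβ hp
  have hx : Real.exp (-(β * p)) < 1 := Real.exp_lt_one_iff.2 (by linarith)
  have h1 : 0 < 1 - Real.exp (-(β * p)) := by linarith
  refine ⟨div_nonneg hp.le h1.le, ?_⟩
  unfold boseWeight
  rw [div_le_iff₀ h1]
  have h2 : Real.exp (-(β * p)) * (β * p + 1) ≤ 1 := by
    have := Real.add_one_le_exp (β * p)
    calc Real.exp (-(β * p)) * (β * p + 1) ≤ Real.exp (-(β * p)) * Real.exp (β * p) := by gcongr
      _ = 1 := by rw [← Real.exp_add]; simp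
  have h3 : (p + 1 / β) = (β * p + 1) / β := by field_simp
  have h4 : (p + 1 / β) * (1 - Real.exp (-(β * p)))
    = p + (1 - Real.exp (-(β * p)) * (β * p + 1)) / β := by field_simp; ring
  rw [h4]
  have : 0 ≤ (1 - Real.exp (-(β * p)) * (β * p + 1)) / β := by
    apply div_nonneg _ hβ.le; linarith
  linarith

lemma measurable_boseWeight (β : ℝ) : Measurable (boseWeight β) := by
  unfold boseWeight
  fun_prop

lemma boseWeight_exp_bound {β δ : ℝ} (hβ : 0 < β) (h0 : 0 ≤ δ) (h1 : δ ≤ β) (p : ℝ) :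
    ‖(boseWeight β p : ℂ) * Real.exp (-(p * δ))‖ ≤ |p| + 1 / β := by
  rw [norm_mul, norm_real, norm_real, Real.norm_eq_abs, Real.norm_eq_abs, Real.abs_exp]
  rcases lt_trichotomy p 0 with hp | rfl | hp
  · have hq : 0 < -p := by linarith
    have hb := boseWeight_pos_bound hβ hq
    have h2 : boseWeight β p = boseWeight β (-p) * Real.exp (-(β * (-p))) := by
      rw [← boseWeight_neg', neg_neg]
    rw [h2, abs_of_nonneg (mul_nonneg hb.1 (Real.exp_pos _).le), abs_of_neg hp, mul_assoc,
      ← Real.exp_add]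
    have h3 : Real.exp (-(β * -p) + -(p * δ)) ≤ 1 := by
      apply Real.exp_le_one_iff.2
      nlinarith
    exact (mul_le_of_le_one_right hb.1 h3).trans hb.2
  · simp [boseWeight]; positivity
  · have hb := boseWeight_pos_bound hβ hp
    rw [abs_of_nonneg hb.1, abs_of_pos hp]
    have h3 : Real.exp (-(p * δ)) ≤ 1 := Real.exp_le_one_iff.2 (by nlinarith)
    exact (mul_le_of_le_one_right hb.1 h3).trans hb.2

lemma integrable_fold {G : ℝ → ℂ} (h1 : IntegrableOn G (Ioi 0))
    (h2 : IntegrableOn (fun p => G (-p)) (Ioi 0)) :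
    Integrable G ∧ ∫ p, G p = (∫ p in Ioi 0, G p) + ∫ p in Ioi 0, G (-p) := by
  have h3 : IntegrableOn G (Iic 0) := by
    rw [integrableOn_Iic_iff_integrableOn_Iio]
    have h2' : IntegrableOn (fun p => G (-p)) (Ioi (-0)) := by rwa [neg_zero]
    simpa using h2'.comp_neg_Iio
  have h4 : Integrable G := by
    rw [← integrableOn_univ, ← Iic_union_Ioi (a := (0 : ℝ))]
    exact h3.union h1
  refine ⟨h4, ?_⟩
  rw [← intervalIntegral.integral_Iic_add_Ioi h3 h1, integral_comp_neg_Ioi, neg_zero, add_comm]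

lemma integrable_half {β : ℝ} (hβ : 0 < β) {z : ℂ} (hz : 0 < z.re) :
    IntegrableOn (fun p : ℝ => (boseWeight β p : ℂ) * Complex.exp (-(p * z))) (Ioi 0) := by
  have i1 := (integral_mul_exp_Ioi (c := (z.re : ℂ)) (by simpa)).1
  have i2' : IntegrableOn (fun p : ℝ => Complex.exp (-(z.re : ℂ) * p)) (Ioi 0) :=
    integrableOn_exp_mul_complex_Ioi (by simpa using hz) 0
  have i2 : Integrable (fun p : ℝ => (1 / β : ℂ) * Complex.exp (-(z.re : ℂ) * p))
    (volume.restrict (Ioi 0)) := Integrable.const_mul i2' _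
  have i3 : Integrable (fun p : ℝ => ‖(p : ℂ) * Complex.exp (-(p * (z.re : ℂ)))‖
      + ‖(1 / β : ℂ) * Complex.exp (-(z.re : ℂ) * p)‖) (volume.restrict (Ioi 0)) :=
    Integrable.add i1.norm i2.norm
  refine Integrable.mono' i3 ?_ ?_
  · refine Measurable.aestronglyMeasurable ?_
    exact (measurable_ofReal.comp (measurable_boseWeight β)).mul (by fun_prop)
  · filter_upwards [ae_restrict_mem measurableSet_Ioi] with p hp
    have hp : 0 < p := hp
    have hb := boseWeight_pos_bound hβ hp
    simp only [norm_mul, Complex.norm_exp, norm_real, Real.norm_of_nonneg hp.le,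
      Real.norm_of_nonneg hb.1]
    have e1 : (-((p : ℂ) * z)).re = -(p * z.re) := by simp
    have e2 : (-((p : ℂ) * (z.re : ℂ))).re = -(p * z.re) := by simp
    have e3 : (-(z.re : ℂ) * p).re = -(p * z.re) := by simp [mul_comm]
    have e4 : ‖(1 / β : ℂ)‖ = 1 / β := by simp [abs_of_pos hβ]
    rw [e1, e2, e3, e4, ← add_mul]
    gcongr
    exact hb.2

lemma kernel_formula {β δ u : ℝ} (hβ : 0 < β) (h0 : 0 < δ) (h1 : δ < β) :
    Integrable (fun p : ℝ => (boseWeight β p : ℂ) * Complex.exp (-(p * (δ + I * u)))) ∧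
    (u ≠ 0 → ∫ p : ℝ, (boseWeight β p : ℂ) * Complex.exp (-(p * (δ + I * u)))
      = -(Real.pi ^ 2 / β ^ 2) /
        Complex.sinh (Real.pi / β * u - I * (Real.pi * δ / β : ℝ)) ^ 2) := by
  set z : ℂ := δ + I * u with hz
  have hzre : z.re = δ := by simp [hz]
  have hzim : z.im = u := by simp [hz]
  have hz1 : 0 < z.re := by rw [hzre]; exact h0
  have hz2 : 0 < ((β : ℂ) - z).re := by simp [hzre]; exact h1
  have hflip : ∀ p : ℝ, (boseWeight β (-p) : ℂ) * Complex.exp (-((-p : ℝ) * z))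
      = (boseWeight β p : ℂ) * Complex.exp (-(p * (β - z))) := by
    intro p
    rw [boseWeight_neg', ofReal_mul, ofReal_exp, mul_assoc, ← Complex.exp_add]
    congr 2
    push_cast; ring
  have hI2 : IntegrableOn (fun p : ℝ => (boseWeight β (-p) : ℂ)
      * Complex.exp (-((-p : ℝ) * z))) (Ioi 0) := by
    simp only [hflip]
    exact integrable_half hβ hz2
  obtain ⟨i1, i2⟩ := integrable_fold (integrable_half hβ hz1) hI2
  refine ⟨i1, fun hu => ?_⟩
  rw [i2]
  simp only [hflip]
  have hform : ∀ p : ℝ, ∀ z : ℂ, (boseWeight β p : ℂ) * Complex.exp (-(p * z))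
      = (p : ℂ) * Complex.exp (-(p * z)) / (1 - Real.exp (-(β * p)) : ℝ) := by
    intro p z
    rw [boseWeight]; push_cast; ring
  simp only [hform]
  have s1 := hasSum_half hβ hz1
  have s2 := hasSum_half hβ hz2
  have hb : (β : ℂ) ≠ 0 := by exact_mod_cast hβ.ne'
  have s3 : HasSum (fun n : ℤ => 1 / (z + n * β) ^ 2) _ := HasSum.of_nat_of_neg_add_one
    (f := fun n : ℤ => 1 / (z + n * β) ^ 2) (by simpa only [Int.cast_natCast] using s1) (m' := _) (by
      convert s2 using 2 with n
      push_cast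
      rw [← neg_sq]
      ring_nf)
  rw [← s3.tsum_eq]
  have hw : (z / β).im ≠ 0 := by
    rw [div_ofReal_im, hzim]; exact div_ne_zero hu hβ.ne'
  have h5 := tsum_int_inv_sq hw
  have h6 : ∀ n : ℤ, 1 / (z + n * β) ^ 2 = 1 / (β : ℂ) ^ 2 * (1 / (z / β + n) ^ 2) := by
    intro n
    rw [one_div_mul_one_div, ← mul_pow]
    congr 2
    field_simp
  simp only [h6]
  rw [tsum_mul_left, h5]
  have h7 : Complex.sin (Real.pi * (z / β)) ^ 2
      = - Complex.sinh (Real.pi / β * u - I * (Real.pi * δ / β : ℝ)) ^ 2 := by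
    have h8 : (Real.pi : ℂ) * (z / β)
        = (Real.pi / β * u - I * (Real.pi * δ / β : ℝ)) * I := by
      rw [hz]; push_cast
      field_simp
      linear_combination (δ : ℂ) * I_sq
    rw [h8, Complex.sin_mul_I, mul_pow, I_sq]; ring
  rw [h7]
  rw [div_neg, one_div_mul_eq_div, neg_div, neg_div]
  congr 1
  rw [div_div, div_div, mul_comm]

/-- The Fourier transform of a test function as a Schwartz function. -/
def schwartzHat {U : Set ℝ} (f : testFunctions U) : SchwartzMap ℝ ℂ :=
  SchwartzMap.compCLMOfContinuousLinearEquiv ℝ (ContinuousLinearEquiv.unitsEquivAut ℝ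
    (Units.mk0 (-(1 / (2 * Real.pi))) (by simp [Real.pi_ne_zero])))
    (FourierTransform.fourier (toSchwartz f))

lemma schwartzHat_apply {U : Set ℝ} (f : testFunctions U) (p : ℝ) :
    schwartzHat f p = fourierHat f p := by
  rw [fourierHat_eq, schwartzHat]
  simp only [SchwartzMap.compCLMOfContinuousLinearEquiv_apply, Function.comp]
  congr 1
  simp [ContinuousLinearEquiv.unitsEquivAut]
  ring

lemma coeFn_embed (β : ℝ) {U : Set ℝ} (f : testFunctions U) :
    embed β U f =ᵐ[thermalMeasure β] fourierHat f :=
  MemLp.coeFn_toLp (memLp_fourierHat β f)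

lemma conj_fourierHat (f : ℝ → ℝ) (p : ℝ) :
    (starRingEnd ℂ) (fourierHat f p) = fourierHat f (-p) := by
  unfold fourierHat
  rw [← integral_conj]
  congr 1
  ext x
  rw [map_mul, conj_ofReal, ← Complex.exp_conj]
  simp

/-- `conj (f̂ p) ĝ(p)`. -/
def sesq {U V : Set ℝ} (f : testFunctions U) (g : testFunctions V) (p : ℝ) : ℂ :=
  (starRingEnd ℂ) (fourierHat f p) * fourierHat g p

lemma sesq_neg {U V : Set ℝ} (f : testFunctions U) (g : testFunctions V) (p : ℝ) :
    sesq f g (-p) = (starRingEnd ℂ) (sesq f g p) := by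
  simp only [sesq, map_mul, conj_fourierHat, neg_neg]

lemma continuous_sesq {U V : Set ℝ} (f : testFunctions U) (g : testFunctions V) :
    Continuous (sesq f g) := by
  have : sesq f g = fun p => (starRingEnd ℂ) (schwartzHat f p) * schwartzHat g p := by
    ext p; simp only [sesq, schwartzHat_apply]
  rw [this]
  exact (Complex.continuous_conj.comp (schwartzHat f).continuous).mul (schwartzHat g).continuous

lemma integrable_sesq {U V : Set ℝ} (f : testFunctions U) (g : testFunctions V) (c : ℝ) :
    Integrable (fun p => (|p| + c) * ‖sesq f g p‖) := by
  obtain ⟨C, hC0, hC⟩ := (schwartzHat f).decay 0 0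
  have h1 := ((schwartzHat g).integrable_pow_mul volume 1).const_mul C
  have h2 := ((schwartzHat g).integrable_pow_mul volume 0).const_mul (C * |c|)
  refine (h1.add h2).mono' ?_ (ae_of_all _ fun p => ?_)
  · exact ((continuous_abs.add continuous_const).mul
      (continuous_sesq f g).norm).aestronglyMeasurable
  · have h3 := hC p
    simp only [norm_iteratedFDeriv_zero, pow_zero, one_mul] at h3
    simp only [Pi.add_apply, pow_zero, one_mul, pow_one, Real.norm_eq_abs, abs_norm, sesq,
      norm_mul, ← schwartzHat_apply, RCLike.norm_conj]
    have h4 : |(|p| + c)| ≤ |p| + |c| := by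
      simpa using abs_add_le |p| c
    calc |(|p| + c)| * (‖schwartzHat f p‖ * ‖schwartzHat g p‖)
        ≤ (|p| + |c|) * (C * ‖schwartzHat g p‖) := by gcongr
      _ = _ := by ring

lemma integrable_bose_sesq {β δ : ℝ} (hβ : 0 < β) (h0 : 0 ≤ δ) (h1 : δ ≤ β) {U V : Set ℝ}
    (f : testFunctions U) (g : testFunctions V) :
    Integrable (fun p : ℝ => ((boseWeight β p : ℂ) * Real.exp (-(p * δ))) * sesq f g p) := by
  refine (integrable_sesq f g (1 / β)).mono' ?_ (ae_of_all _ fun p => ?_)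
  · refine AEStronglyMeasurable.mul ?_ (continuous_sesq f g).aestronglyMeasurable
    exact ((measurable_ofReal.comp (measurable_boseWeight β)).mul
      (by fun_prop)).aestronglyMeasurable
  · rw [norm_mul]
    gcongr
    exact boseWeight_exp_bound hβ h0 h1 p

lemma integral_thermalMeasure {β : ℝ} (hβ : 0 < β) (F : ℝ → ℝ) :
    ∫ p, F p ∂(thermalMeasure β) = ∫ p in Ioi 0, thermalWeight β p * F p := by
  unfold thermalMeasure
  rw [integral_withDensity_eq_integral_toReal_smul (measurable_thermalWeight β).ennreal_ofReal
    (by simp)]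
  refine setIntegral_congr_fun measurableSet_Ioi fun p hp => ?_
  have hp : 0 < p := hp
  have : 0 ≤ thermalWeight β p := by
    unfold thermalWeight
    have h1 := Real.cosh_pos (β * p / 2)
    have h2 : 0 < Real.sinh (β * p / 2) := Real.sinh_pos_iff.2 (by positivity)
    have := Real.pi_pos
    positivity
  simp only [smul_eq_mul]
  rw [ENNReal.toReal_ofReal this]

lemma thermalWeight_eq {β p : ℝ} (hβ : 0 < β) (hp : 0 < p) :
    thermalWeight β p = (boseWeight β p + boseWeight β (-p)) / Real.pi ∧
    thermalWeight β p * thermalTanh β p = (boseWeight β p - boseWeight β (-p)) / Real.pi := by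
  have hs : 0 < Real.sinh (β * p / 2) := Real.sinh_pos_iff.2 (by positivity)
  have hc := Real.cosh_pos (β * p / 2)
  rw [boseWeight_neg]
  unfold boseWeight thermalWeight thermalTanh
  rw [Real.tanh_eq_sinh_div_cosh]
  set y := β * p / 2
  have e : Real.exp (-(β * p)) = Real.exp (-y) ^ 2 := by
    rw [← Real.exp_nat_mul]; congr 1; simp only [y]; push_cast; ring
  have hs' : Real.sinh y = (Real.exp y - Real.exp (-y)) / 2 := Real.sinh_eq y
  have hc' : Real.cosh y = (Real.exp y + Real.exp (-y)) / 2 := Real.cosh_eq y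
  have hE : Real.exp y * Real.exp (-y) = 1 := by rw [← Real.exp_add]; simp
  have hx : 0 < Real.exp (-y) := Real.exp_pos _
  have h1 : 1 - Real.exp (-y) ^ 2 = 2 * Real.exp (-y) * Real.sinh y := by
    rw [hs', ← hE]; ring
  have hpi := Real.pi_pos
  have h2 : 2 * Real.exp (-y) * Real.cosh y = 1 + Real.exp (-y) ^ 2 := by
    rw [hc', ← hE]; ring
  rw [e, h1]
  constructor
  · field_simp
    linear_combination h2
  · field_simp
    linear_combination -h1

/-- On `𝒦 ⊕ 0` the inner product is the thermal two-point function in momentum space. -/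
lemma inner_embed_eq {β : ℝ} (hβ : 0 < β) {U V : Set ℝ} (f : testFunctions U)
    (g : testFunctions V) :
    inner ℂ (Purified.mk (embed β U f) 0) (Purified.mk (embed β V g) 0)
      = (1 / Real.pi : ℂ) * ∫ p : ℝ, (boseWeight β p : ℂ) * sesq f g p := by
  have hI : Integrable (fun p : ℝ => (boseWeight β p : ℂ) * sesq f g p) := by
    simpa using integrable_bose_sesq hβ le_rfl hβ.le f g
  have hI' : Integrable (fun p : ℝ => (boseWeight β (-p) : ℂ) * sesq f g (-p)) := hI.comp_neg
  rw [(integrable_fold hI.integrableOn hI'.integrableOn).2,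
    ← integral_add hI.integrableOn hI'.integrableOn, ← integral_const_mul]
  have hJ : Integrable (fun p : ℝ => (1 / Real.pi : ℂ) * ((boseWeight β p : ℂ) * sesq f g p
      + (boseWeight β (-p) : ℂ) * sesq f g (-p))) (volume.restrict (Ioi 0)) :=
    ((hI.add hI').const_mul _).integrableOn
  rw [Purified.inner_def]
  apply Complex.ext
  · have h1 : inner ℝ (Purified.toDoubled (Purified.mk (embed β U f) 0))
        (Purified.toDoubled (Purified.mk (embed β V g) 0))
        = inner ℝ (embed β U f) (embed β V g) := by
      rw [WithLp.prod_inner_apply]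
      change inner ℝ (embed β U f) (embed β V g)
        + inner ℝ (0 : OneParticle β) (0 : OneParticle β) = _
      simp
    change inner ℝ _ _ = _
    rw [h1, L2.inner_def]
    rw [integral_congr_ae (g := fun p => (sesq f g p).re) ?_, integral_thermalMeasure hβ]
    · refine Eq.trans ?_ (reCLM.integral_comp_comm hJ)
      refine setIntegral_congr_fun measurableSet_Ioi fun p hp => ?_
      simp only [reCLM_apply]
      rw [(thermalWeight_eq hβ hp).1, sesq_neg, ← ofReal_one, ← ofReal_div, re_ofReal_mul, add_re,
        re_ofReal_mul, re_ofReal_mul, conj_re]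
      ring
    · filter_upwards [coeFn_embed β f, coeFn_embed β g] with p h2 h3
      rw [h2, h3, Complex.inner, sesq, mul_comm]
  · have h1 : inner ℝ (Purified.toDoubled (Purified.mk (embed β U f) 0))
        (-(iPlus β (Purified.toDoubled (Purified.mk (embed β V g) 0))))
        = inner ℝ (embed β U f) (opD β (embed β V g)) := by
      rw [inner_neg_right, WithLp.prod_inner_apply]
      change -(inner ℝ (embed β U f) (-(opD β (embed β V g)) + opC β (opR β 0))
        + inner ℝ (0 : OneParticle β) _) = _
      simp
    change inner ℝ _ _ = _
    rw [h1, L2.inner_def]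
    rw [integral_congr_ae (g := fun p => thermalTanh β p * (sesq f g p).im) ?_,
      integral_thermalMeasure hβ]
    · refine Eq.trans ?_ (imCLM.integral_comp_comm hJ)
      refine setIntegral_congr_fun measurableSet_Ioi fun p hp => ?_
      simp only [imCLM_apply]
      rw [← mul_assoc, (thermalWeight_eq hβ hp).2, sesq_neg, ← ofReal_one, ← ofReal_div,
        im_ofReal_mul, add_im, im_ofReal_mul, im_ofReal_mul, conj_im]
      ring
    · filter_upwards [coeFn_embed β f, coeFn_embed β g,
        coeFn_mulOp β _ (memLp_const_I β) (opAbsD β (embed β V g)),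
        coeFn_mulOp β _ (memLp_tanh β) (embed β V g)] with p h2 h3 h4 h5
      change inner ℝ (embed β U f p)
        ((mulOp β _ (memLp_const_I β) (opAbsD β (embed β V g))) p) = _
      rw [h4]
      change inner ℝ (embed β U f p) (-I * (mulOp β _ (memLp_tanh β) (embed β V g)) p) = _
      rw [h5, h2, h3, Complex.inner, sesq]
      simp
      ring

lemma swap_phase {h E : ℝ → ℂ} (hh : Integrable h) (hE : Integrable E) (s : ℝ) :
    ∫ x, h x * ∫ p, E p * Complex.exp (I * (s * x * p : ℝ))
      = ∫ p, E p * ∫ x, h x * Complex.exp (I * (s * x * p : ℝ)) := by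
  have hint : Integrable (fun q : ℝ × ℝ => (h q.1 * E q.2)
      * Complex.exp (I * (s * q.1 * q.2 : ℝ))) (volume.prod volume) := by
    refine (hh.mul_prod hE).mul_bdd (c := 1) (by fun_prop) (ae_of_all _ fun q => ?_)
    rw [mul_comm, Complex.norm_exp_ofReal_mul_I]
  have e1 : ∀ x, h x * ∫ p, E p * Complex.exp (I * (s * x * p : ℝ))
      = ∫ p, (h x * E p) * Complex.exp (I * (s * x * p : ℝ)) := fun x => by
    rw [← integral_const_mul]; simp only [mul_assoc]
  have e2 : ∀ p, E p * ∫ x, h x * Complex.exp (I * (s * x * p : ℝ))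
      = ∫ x, (h x * E p) * Complex.exp (I * (s * x * p : ℝ)) := fun p => by
    rw [← integral_const_mul]; congr 1; ext x; ring
  simp only [e1, e2]
  exact integral_integral_swap hint

/-- The regularised thermal two-point function
`-π ∫∫ f(x) g(y) / (β² sinh²((π/β)(x - y) - i ε)) dx dy`. -/
def twoPointReg (β ε : ℝ) (f g : ℝ → ℝ) : ℂ :=
  -(Real.pi : ℂ) * ∫ x : ℝ, ∫ y : ℝ, (f x : ℂ) * (g y : ℂ) /
    ((β : ℂ) ^ 2 * Complex.sinh (Real.pi / β * (x - y) - I * ε) ^ 2)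

lemma integrable_test {U : Set ℝ} (f : testFunctions U) :
    Integrable (fun x => ((f : ℝ → ℝ) x : ℂ)) := (toSchwartz f).integrable

lemma twoPointReg_eq {β δ : ℝ} (hβ : 0 < β) (h0 : 0 < δ) (h1 : δ < β) {U V : Set ℝ}
    (f : testFunctions U) (g : testFunctions V) :
    twoPointReg β (Real.pi * δ / β) f g = (1 / Real.pi : ℂ) *
      ∫ p : ℝ, ((boseWeight β p : ℂ) * Real.exp (-(p * δ))) * sesq f g p := by
  have hpi : (Real.pi : ℂ) ≠ 0 := by exact_mod_cast Real.pi_ne_zero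
  set E : ℝ → ℂ := fun p => (boseWeight β p : ℂ) * Real.exp (-(p * δ)) with hE
  have hEi : Integrable E := by
    have := (kernel_formula (u := 0) hβ h0 h1).1
    refine this.congr (ae_of_all _ fun p => ?_)
    simp [hE]
  have hV : ∀ u : ℝ, u ≠ 0 → -(Real.pi ^ 2 / β ^ 2 : ℂ) /
        Complex.sinh (Real.pi / β * u - I * (Real.pi * δ / β : ℝ)) ^ 2
        = ∫ p, E p * Complex.exp (I * (-(1 : ℝ) * u * p : ℝ)) := by
    intro u hu
    rw [← (kernel_formula hβ h0 h1).2 hu]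
    congr 1
    ext p
    simp only [hE]
    rw [ofReal_exp, mul_assoc, ← Complex.exp_add]
    congr 2
    push_cast; ring
  have hstep1 : ∀ x : ℝ, ∫ y : ℝ, ((f : ℝ → ℝ) x : ℂ) * ((g : ℝ → ℝ) y : ℂ) /
      ((β : ℂ) ^ 2 * Complex.sinh (Real.pi / β * (x - y) - I * (Real.pi * δ / β : ℝ)) ^ 2)
      = (-(1 / Real.pi ^ 2) : ℂ) * (((f : ℝ → ℝ) x : ℂ) *
        ∫ p, (E p * fourierHat g p) * Complex.exp (I * (-(1 : ℝ) * x * p : ℝ))) := by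
    intro x
    have hEx : Integrable (fun p : ℝ => E p * Complex.exp (I * (-(1 : ℝ) * x * p : ℝ))) := by
      refine hEi.mul_bdd (c := 1) (by fun_prop) (ae_of_all _ fun q => ?_)
      rw [mul_comm, Complex.norm_exp_ofReal_mul_I]
    have hsw := swap_phase (integrable_test g) hEx 1
    have e1 : ∫ p, (E p * fourierHat g p) * Complex.exp (I * (-(1 : ℝ) * x * p : ℝ))
        = ∫ p, (E p * Complex.exp (I * (-(1 : ℝ) * x * p : ℝ))) *
          ∫ y, ((g : ℝ → ℝ) y : ℂ) * Complex.exp (I * (1 * y * p : ℝ)) := by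
      congr 1
      ext p
      rw [fourierHat, mul_right_comm]
      congr 2
      ext y
      rw [mul_comm]
      congr 2
      push_cast; ring
    rw [e1, ← hsw, ← integral_const_mul, ← integral_const_mul]
    apply integral_congr_ae
    have hne : ∀ᵐ y : ℝ, y ≠ x := by
      simp [ae_iff]
    filter_upwards [hne] with y hy
    have e2 : ∫ p, E p * Complex.exp (I * (-(1 : ℝ) * x * p : ℝ)) * Complex.exp (I * (1 * y * p : ℝ))
        = ∫ p, E p * Complex.exp (I * (-(1 : ℝ) * (x - y) * p : ℝ)) := by
      congr 1
      ext p
      rw [mul_assoc, ← Complex.exp_add]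
      congr 2
      push_cast; ring
    rw [e2, ← hV (x - y) (sub_ne_zero.2 hy.symm)]
    push_cast
    field_simp
  have hEg : Integrable (fun p => E p * fourierHat g p) := by
    obtain ⟨C, hC0, hC⟩ := (schwartzHat g).decay 0 0
    refine hEi.mul_bdd (c := C) ?_ (ae_of_all _ fun p => ?_)
    · have : fourierHat g = schwartzHat g := by ext p; rw [schwartzHat_apply]
      rw [this]
      exact (schwartzHat g).continuous.aestronglyMeasurable
    · rw [← schwartzHat_apply]; simpa using hC p
  unfold twoPointReg
  simp only [hstep1]
  rw [integral_const_mul, swap_phase (integrable_test f) hEg (-1)]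
  rw [← mul_assoc]
  congr 1
  · field_simp
  · congr 1
    ext p
    rw [mul_assoc, sesq, conj_fourierHat, mul_comm (fourierHat _ _)]
    congr 2
    unfold fourierHat
    congr 1
    ext x
    rw [mul_comm]
    congr 2
    push_cast; ring

/-- On `𝒦 ⊕ 0` the inner product of `ℋ^⊕` is the thermal two-point function, the boundary value
at `ε → 0+` of its regularisation in position space. -/
theorem tendsto_twoPointReg {β : ℝ} (hβ : 0 < β) {U V : Set ℝ} (f : testFunctions U)
    (g : testFunctions V) :
    Tendsto (fun ε : ℝ => twoPointReg β ε f g) (𝓝[>] 0)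
      (𝓝 (inner ℂ (Purified.mk (embed β U f) 0) (Purified.mk (embed β V g) 0))) := by
  rw [inner_embed_eq hβ]
  have hpi := Real.pi_pos
  have h1 : Tendsto (fun δ : ℝ => (1 / Real.pi : ℂ) *
      ∫ p : ℝ, ((boseWeight β p : ℂ) * Real.exp (-(p * δ))) * sesq f g p) (𝓝[>] 0)
      (𝓝 ((1 / Real.pi : ℂ) * ∫ p : ℝ, (boseWeight β p : ℂ) * sesq f g p)) := by
    refine Tendsto.const_mul _ ?_
    refine tendsto_integral_filter_of_dominated_convergence
      (fun p => (|p| + 1 / β) * ‖sesq f g p‖) ?_ ?_ (integrable_sesq f g _) ?_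
    · filter_upwards [Ioo_mem_nhdsGT hβ] with δ hδ
      exact (integrable_bose_sesq hβ hδ.1.le hδ.2.le f g).1
    · filter_upwards [Ioo_mem_nhdsGT hβ] with δ hδ
      refine ae_of_all _ fun p => ?_
      rw [norm_mul]
      gcongr
      exact boseWeight_exp_bound hβ hδ.1.le hδ.2.le p
    · refine ae_of_all _ fun p => ?_
      have : Continuous fun δ : ℝ => ((boseWeight β p : ℂ) * Real.exp (-(p * δ))) * sesq f g p := by
        fun_prop
      have h := (this.tendsto 0).mono_left (nhdsWithin_le_nhds (s := Ioi 0))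
      simpa using h
  have h2 : Tendsto (fun ε : ℝ => β * ε / Real.pi) (𝓝[>] 0) (𝓝[>] 0) := by
    refine tendsto_nhdsWithin_iff.2 ⟨?_, ?_⟩
    · have : Continuous fun ε : ℝ => β * ε / Real.pi := by fun_prop
      have h := (this.tendsto 0).mono_left (nhdsWithin_le_nhds (s := Ioi 0))
      simpa using h
    · filter_upwards [self_mem_nhdsWithin] with ε hε
      have : 0 < ε := hε
      exact div_pos (mul_pos hβ this) hpi
  refine (h1.comp h2).congr' ?_
  filter_upwards [Ioo_mem_nhdsGT hpi] with ε hε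
  have h3 := twoPointReg_eq hβ (δ := β * ε / Real.pi) (div_pos (mul_pos hβ hε.1) hpi)
    (by rw [div_lt_iff₀ hpi]; exact mul_lt_mul_of_pos_left hε.2 hβ) f g
  have h4 : Real.pi * (β * ε / Real.pi) / β = ε := by field_simp
  rw [h4] at h3
  exact h3.symm

/-- The symplectic form of `ℋ^⊕` restricts on `𝒦 ⊕ 0` to `σ(f, g) = ∫ f g'`. -/
theorem im_inner_embed {β : ℝ} (hβ : 0 < β) {U V : Set ℝ} (f : testFunctions U)
    (g : testFunctions V) :
    (inner ℂ (Purified.mk (embed β U f) 0) (Purified.mk (embed β V g) 0)).im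
      = ∫ x, (f : ℝ → ℝ) x * deriv (g : ℝ → ℝ) x := by
  have hpi : (Real.pi : ℂ) ≠ 0 := by exact_mod_cast Real.pi_ne_zero
  rw [inner_embed_eq hβ]
  have hI : Integrable (fun p : ℝ => (boseWeight β p : ℂ) * sesq f g p) := by
    simpa using integrable_bose_sesq hβ le_rfl hβ.le f g
  have hI' : Integrable (fun p : ℝ => (boseWeight β (-p) : ℂ) * (starRingEnd ℂ) (sesq f g p)) := by
    simpa only [sesq_neg] using hI.comp_neg
  have hdiff : ∀ᵐ p : ℝ, boseWeight β p - boseWeight β (-p) = p := by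
    have : ∀ᵐ p : ℝ, p ≠ 0 := by simp [ae_iff]
    filter_upwards [this] with p hp
    rw [boseWeight_neg, boseWeight, ← sub_div, ← mul_one_sub, mul_div_assoc, div_self, mul_one]
    rw [sub_ne_zero]
    intro h
    have := (Real.exp_eq_one_iff _).1 h.symm
    simp [hβ.ne', hp] at this
  -- the anti-Hermitian part
  have e1 : (starRingEnd ℂ) (∫ p : ℝ, (boseWeight β p : ℂ) * sesq f g p)
      = ∫ p : ℝ, (boseWeight β (-p) : ℂ) * sesq f g p := by
    rw [← integral_conj, ← integral_neg_eq_self]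
    congr 1
    ext p
    rw [map_mul, sesq_neg, conj_conj, conj_ofReal]
  have e2 : (∫ p : ℝ, (boseWeight β p : ℂ) * sesq f g p)
      - (starRingEnd ℂ) (∫ p : ℝ, (boseWeight β p : ℂ) * sesq f g p)
      = ∫ p : ℝ, (p : ℂ) * sesq f g p := by
    rw [e1, ← integral_sub hI ?_]
    · apply integral_congr_ae
      filter_upwards [hdiff] with p hp
      rw [← sub_mul, ← ofReal_sub, hp]
    · have := hI.comp_neg
      have h2 : Integrable (fun p : ℝ => (starRingEnd ℂ) ((boseWeight β (-p) : ℂ)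
        * sesq f g (-p))) := (Complex.conjCLE.toContinuousLinearMap.integrable_comp this)
      refine h2.congr (ae_of_all _ fun p => ?_)
      simp only [map_mul, sesq_neg, conj_conj, conj_ofReal]
  have e3 : ∫ p : ℝ, (p : ℂ) * sesq f g p = 2 * Real.pi * I *
      ((∫ x, (f : ℝ → ℝ) x * deriv (g : ℝ → ℝ) x : ℝ) : ℂ) := by
    have hP := SchwartzMap.integral_inner_fourier_fourier (toSchwartz f)
      (SchwartzMap.derivCLM ℂ ℂ (toSchwartz g))
    have hR : ∫ x, inner ℂ (toSchwartz f x) (SchwartzMap.derivCLM ℂ ℂ (toSchwartz g) x)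
        = ((∫ x, (f : ℝ → ℝ) x * deriv (g : ℝ → ℝ) x : ℝ) : ℂ) := by
      rw [← integral_complex_ofReal]
      congr 1
      ext x
      have hd : deriv (toSchwartz g) x = ((deriv (g : ℝ → ℝ) x : ℝ) : ℂ) :=
        (((g.2.1.differentiable (by simp)) x).hasDerivAt.ofReal_comp).deriv
      rw [SchwartzMap.derivCLM_apply, hd, toSchwartz_apply]
      simp [mul_comm]
    rw [← hR, ← hP]
    have hF : ∀ ξ : ℝ, inner ℂ (FourierTransform.fourier (toSchwartz f) ξ)
        (FourierTransform.fourier (SchwartzMap.derivCLM ℂ ℂ (toSchwartz g)) ξ)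
        = (fun p : ℝ => -I * ((p : ℂ) * sesq f g p)) (-(2 * Real.pi) * ξ) := by
      intro ξ
      have h1 : FourierTransform.fourier (SchwartzMap.derivCLM ℂ ℂ (toSchwartz g)) ξ
          = (2 * Real.pi * I * ξ) • FourierTransform.fourier (toSchwartz g) ξ := by
        have h := Real.fourier_deriv (f := toSchwartz g) (toSchwartz g).integrable
          (toSchwartz g).differentiable
          (SchwartzMap.derivCLM ℂ ℂ (toSchwartz g)).integrable
        rw [SchwartzMap.fourier_coe, SchwartzMap.fourier_coe]
        exact congrFun h ξ
      have h2 : ∀ {U : Set ℝ} (f : testFunctions U), FourierTransform.fourier (toSchwartz f) ξ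
          = fourierHat f (-(2 * Real.pi) * ξ) := by
        intro U f
        rw [fourierHat_eq]
        congr 1
        have := Real.pi_ne_zero
        field_simp
      rw [h1, h2, h2]
      simp only [sesq, RCLike.inner_apply, smul_eq_mul]
      push_cast
      linear_combination (0 : ℂ) * I_sq
    simp only [hF]
    rw [Measure.integral_comp_mul_left (fun p : ℝ => -I * ((p : ℂ) * sesq f g p)),
      integral_const_mul]
    have habs : |(-(2 * Real.pi))⁻¹| = (2 * Real.pi)⁻¹ := by
      rw [abs_inv, abs_neg, abs_of_pos (by positivity)]
    rw [habs, Complex.real_smul]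
    push_cast
    field_simp
    linear_combination (∫ p : ℝ, (p : ℂ) * sesq f g p) * I_sq
  rw [e3, Complex.sub_conj] at e2
  have e4 : (∫ p : ℝ, (boseWeight β p : ℂ) * sesq f g p).im
      = Real.pi * ∫ x, (f : ℝ → ℝ) x * deriv (g : ℝ → ℝ) x := by
    have h5 : ((2 * (∫ p : ℝ, (boseWeight β p : ℂ) * sesq f g p).im : ℝ) : ℂ)
        = ((2 * (Real.pi * ∫ x, (f : ℝ → ℝ) x * deriv (g : ℝ → ℝ) x) : ℝ) : ℂ) := by
      apply mul_right_cancel₀ I_ne_zero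
      rw [e2]; push_cast; ring
    have h6 := Complex.ofReal_injective h5
    linarith
  rw [← ofReal_one, ← ofReal_div, im_ofReal_mul, e4]
  field_simp

lemma ae_eq_zero_of_phase {H : ℝ → ℂ} (hH : Integrable H)
    (h : ∀ t : ℝ, ∫ p, H p * Complex.exp (I * (t * p : ℝ)) = 0) : ∀ᵐ p, H p = 0 := by
  refine ae_eq_zero_of_integral_contDiff_smul_eq_zero hH.locallyIntegrable fun ψ h1 h2 => ?_
  set S := toSchwartz (U := univ) ⟨ψ, h1, h2, subset_univ _⟩ with hS
  have hsw := swap_phase (FourierTransform.fourier S).integrable hH (2 * Real.pi)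
  have hz : ∀ x : ℝ, ∫ p, H p * Complex.exp (I * (2 * Real.pi * x * p : ℝ)) = 0 :=
    fun x => h (2 * Real.pi * x)
  simp only [hz, mul_zero, integral_zero] at hsw
  rw [hsw]
  congr 1
  ext p
  have hinv : FourierTransform.fourierInv (FourierTransform.fourier S) p = S p := by
    rw [FourierTransform.fourierInv_fourier_eq]
  have hSp : S p = (ψ p : ℂ) := rfl
  rw [Complex.real_smul, ← hSp, ← hinv, mul_comm, SchwartzMap.fourierInv_coe,
    Real.fourierInv_eq']
  congr 2
  ext v
  rw [smul_eq_mul, mul_comm]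
  congr 2
  simp only [RCLike.inner_apply, conj_trivial]
  push_cast; ring

lemma exists_fourierHat_ne_zero (N : ℝ) (hN : 0 < N) :
    ∃ f : testFunctions univ, ∀ p ∈ Ioo (0 : ℝ) N, fourierHat f p ≠ 0 := by
  let φ : ContDiffBump (0 : ℝ) := ⟨1 / (2 * N), 1 / N, by positivity, by
    apply one_div_lt_one_div_of_lt hN; linarith⟩
  refine ⟨⟨φ, φ.contDiff, φ.hasCompactSupport, subset_univ _⟩, fun p hp h0 => ?_⟩
  have hint : Integrable (fun x : ℝ => Complex.exp (I * x * p) * (φ x : ℂ)) := by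
    refine (integrable_test ⟨φ, φ.contDiff, φ.hasCompactSupport, subset_univ _⟩).bdd_mul
      (c := 1) (by fun_prop) (ae_of_all _ fun x => ?_)
    rw [mul_assoc, mul_comm, ← ofReal_mul, Complex.norm_exp_ofReal_mul_I]
  have h1 : (fourierHat φ p).re = ∫ x, Real.cos (x * p) * φ x := by
    unfold fourierHat
    refine (reCLM.integral_comp_comm hint).symm.trans ?_
    congr 1
    ext x
    rw [reCLM_apply, re_mul_ofReal, mul_assoc, mul_comm I, ← ofReal_mul, exp_ofReal_mul_I_re]
  have hpos : 0 < ∫ x, φ x := φ.integral_pos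
  have hcos : 0 < Real.cos 1 := Real.cos_one_pos
  have hle : ∫ x, Real.cos 1 * φ x ≤ ∫ x, Real.cos (x * p) * φ x := by
    refine integral_mono (φ.integrable.const_mul _) ?_ fun x => ?_
    · refine hint.re.congr (ae_of_all _ fun x => ?_)
      change (Complex.exp (I * x * p) * (φ x : ℂ)).re = _
      rw [re_mul_ofReal, mul_assoc, mul_comm I, ← ofReal_mul, exp_ofReal_mul_I_re]
    · by_cases hx : |x| < 1 / N
      · have h2 : |x * p| ≤ 1 := by
          rw [abs_mul, abs_of_pos hp.1]
          calc |x| * p ≤ 1 / N * N := by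
                gcongr
                · exact hp.1.le
                · exact hp.2.le
            _ = 1 := by field_simp
        have h3 : Real.cos 1 ≤ Real.cos (x * p) := by
          rw [← Real.cos_abs (x * p)]
          exact Real.cos_le_cos_of_nonneg_of_le_pi (abs_nonneg _)
            (by linarith [Real.pi_gt_three]) h2
        exact mul_le_mul_of_nonneg_right h3 φ.nonneg
      · have : φ x = 0 := φ.zero_of_le_dist (by
          rw [Real.dist_eq, sub_zero]; exact not_lt.1 hx)
        simp [this]
  rw [integral_const_mul] at hle
  have h4 : (fourierHat φ p).re = 0 := by
    have : fourierHat φ p = 0 := h0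
    rw [this]; rfl
  rw [h4] at h1
  rw [← h1] at hle
  have := mul_pos hcos hpos
  linarith

/-- The test function `x ↦ f (x - t)`. -/
def translate (f : testFunctions univ) (t : ℝ) : testFunctions univ :=
  ⟨fun x => (f : ℝ → ℝ) (x - t), f.2.1.comp (by fun_prop),
    f.2.2.1.comp_homeomorph (Homeomorph.subRight t), subset_univ _⟩

lemma fourierHat_translate (f : testFunctions univ) (t p : ℝ) :
    fourierHat (translate f t) p = Complex.exp (I * (t * p : ℝ)) * fourierHat f p := by
  unfold fourierHat
  rw [← integral_const_mul, ← integral_add_right_eq_self _ t]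
  congr 1
  ext x
  have : (translate f t : ℝ → ℝ) (x + t) = (f : ℝ → ℝ) x := by
    change (f : ℝ → ℝ) (x + t - t) = _
    rw [add_sub_cancel_right]
  rw [this, ← mul_assoc, ← Complex.exp_add]
  congr 2
  push_cast; ring

/-- The test functions are dense in `𝒦`, so that `𝒦` is their completion for `τ_β`. -/
theorem dense_testFunctions {β : ℝ} (hβ : 0 < β) :
    (LinearMap.range (embed β univ)).topologicalClosure = ⊤ := by
  rw [Submodule.topologicalClosure_eq_top_iff, Submodule.eq_bot_iff]
  intro u hu
  have horth : ∀ f : testFunctions univ, inner ℝ (embed β univ f) u = 0 := fun f =>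
    (Submodule.mem_orthogonal _ _).1 hu _ ⟨f, rfl⟩
  have hwpos : ∀ p ∈ Ioi (0 : ℝ), 0 < thermalWeight β p := fun p hp => by
    have hp : 0 < p := hp
    unfold thermalWeight
    have h1 := Real.cosh_pos (β * p / 2)
    have h2 : 0 < Real.sinh (β * p / 2) := Real.sinh_pos_iff.2 (by positivity)
    have := Real.pi_pos
    positivity
  have hmain : ∀ f : testFunctions univ, ∀ᵐ p ∂(volume.restrict (Ioi (0 : ℝ))),
      (starRingEnd ℂ) (fourierHat f p) * u p = 0 := by
    intro f
    set K : ℝ → ℂ := fun p => (starRingEnd ℂ) (fourierHat f p) * u p with hK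
    have hKi : Integrable K (thermalMeasure β) := by
      have h1 : Integrable (fun p => inner ℂ (embed β univ f p) (u p)) (thermalMeasure β) :=
        L2.integrable_inner (𝕜 := ℂ) (embed β univ f) u
      refine h1.congr ?_
      filter_upwards [coeFn_embed β f] with p hp
      rw [hp, RCLike.inner_apply, mul_comm]
    set G : ℝ → ℂ := fun p => (thermalWeight β p : ℂ) * K p with hG
    have hGi : IntegrableOn G (Ioi 0) := by
      have h2 := hKi
      unfold thermalMeasure at h2
      rw [integrable_withDensity_iff_integrable_smul' (measurable_thermalWeight β).ennreal_ofReal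
        (by simp)] at h2
      refine h2.congr ?_
      filter_upwards [ae_restrict_mem measurableSet_Ioi] with p hp
      rw [ENNReal.toReal_ofReal (hwpos p hp).le, Complex.real_smul]
    set H : ℝ → ℂ := fun p => if 0 < p then G p else (starRingEnd ℂ) (G (-p)) with hH
    have hH1 : ∀ p ∈ Ioi (0 : ℝ), H p = G p := fun p hp => if_pos hp
    have hH2 : ∀ p ∈ Ioi (0 : ℝ), H (-p) = (starRingEnd ℂ) (G p) := fun p hp => by
      have hp : 0 < p := hp
      simp only [hH]
      rw [if_neg (by linarith), neg_neg]
    have hGc : IntegrableOn (fun p => (starRingEnd ℂ) (G p)) (Ioi 0) :=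
      Complex.conjCLE.toContinuousLinearMap.integrable_comp hGi
    have hHi := (integrable_fold (G := H)
      (hGi.congr_fun (fun p hp => (hH1 p hp).symm) measurableSet_Ioi)
      (hGc.congr_fun (fun p hp => (hH2 p hp).symm) measurableSet_Ioi)).1
    have hzero : ∀ t : ℝ, ∫ p, H p * Complex.exp (I * (t * p : ℝ)) = 0 := by
      intro t
      have hbd : ∀ {E : ℝ → ℂ} {μ : Measure ℝ}, Integrable E μ →
          Integrable (fun p => E p * Complex.exp (I * (t * p : ℝ))) μ := fun hE => by
        refine hE.mul_bdd (c := 1) (by fun_prop) (ae_of_all _ fun q => ?_)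
        rw [mul_comm, Complex.norm_exp_ofReal_mul_I]
      have hPi := hbd hHi
      have hGe : Integrable (fun p => G p * Complex.exp (I * (t * p : ℝ)))
        (volume.restrict (Ioi 0)) := hbd hGi
      rw [(integrable_fold hPi.integrableOn hPi.comp_neg.integrableOn).2]
      have e1 : ∫ p in Ioi (0 : ℝ), H p * Complex.exp (I * (t * p : ℝ))
          = ∫ p in Ioi (0 : ℝ), G p * Complex.exp (I * (t * p : ℝ)) :=
        setIntegral_congr_fun measurableSet_Ioi fun p hp => by rw [hH1 p hp]
      have e2 : ∫ p in Ioi (0 : ℝ), H (-p) * Complex.exp (I * (t * (-p) : ℝ))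
          = (starRingEnd ℂ) (∫ p in Ioi (0 : ℝ), G p * Complex.exp (I * (t * p : ℝ))) := by
        rw [← integral_conj]
        refine setIntegral_congr_fun measurableSet_Ioi fun p hp => ?_
        rw [hH2 p hp, map_mul (starRingEnd ℂ) (G p) (Complex.exp _), ← Complex.exp_conj]
        congr 2
        simp
      rw [e1, e2, Complex.add_conj]
      have e3 : (∫ p in Ioi (0 : ℝ), G p * Complex.exp (I * (t * p : ℝ))).re
          = inner ℝ (embed β univ (translate f (-t))) u := by
        rw [L2.inner_def, integral_congr_ae
          (g := fun p => (K p * Complex.exp (I * (t * p : ℝ))).re) ?_,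
          integral_thermalMeasure hβ]
        · refine (reCLM.integral_comp_comm hGe).symm.trans ?_
          refine setIntegral_congr_fun measurableSet_Ioi fun p hp => ?_
          simp only [reCLM_apply, hG]
          rw [mul_assoc, re_ofReal_mul]
        · filter_upwards [coeFn_embed β (translate f (-t))] with p hp
          rw [hp, Complex.inner, fourierHat_translate, map_mul, ← Complex.exp_conj]
          congr 1
          simp only [hK]
          have : (starRingEnd ℂ) (I * ((-t * p : ℝ) : ℂ)) = I * (t * p : ℝ) := by
            simp
          rw [this]; ring
      rw [e3, horth]; simp
    have := ae_eq_zero_of_phase hHi hzero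
    filter_upwards [ae_restrict_of_ae this, ae_restrict_mem measurableSet_Ioi] with p h1 hp
    rw [hH1 p hp, hG] at h1
    rcases mul_eq_zero.1 h1 with h2 | h2
    · exact absurd (ofReal_eq_zero.1 h2) (hwpos p hp).ne'
    · exact h2
  choose F hF using fun n : ℕ => exists_fourierHat_ne_zero (n + 1) (by positivity)
  have hall : ∀ᵐ p ∂(volume.restrict (Ioi (0 : ℝ))), u p = 0 := by
    filter_upwards [ae_all_iff.2 fun n => hmain (F n), ae_restrict_mem measurableSet_Ioi]
      with p h1 hp
    obtain ⟨n, hn⟩ := exists_nat_gt p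
    rcases mul_eq_zero.1 (h1 n) with h2 | h2
    · exact absurd ((map_eq_zero _).1 h2) (hF n p ⟨hp, by linarith⟩)
    · exact h2
  apply Lp.ext
  have hac : thermalMeasure β ≪ volume.restrict (Ioi 0) := withDensity_absolutelyContinuous _ _
  filter_upwards [hac.ae_le hall, Lp.coeFn_zero ℂ 2 (thermalMeasure β)] with p h1 h2
  rw [h1, h2]; rfl

end ThermalCurrent

end

noncomputable section

namespace ThermalCurrent

open MeasureTheory Set Complex Filter Topology
open scoped ENNReal ContDiff

/-! Separation is algebraic. The second component of `i^⊕ (x, 0)` is `C √(1 + D²) x`, and this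
operator is injective because `1 / cosh (β p / 2)` has no zero; so `i^⊕` sends no nonzero vector of
`𝒦 ⊕ 0` back into `𝒦 ⊕ 0`.

Cyclicity is a Reeh-Schlieder argument. A vector `u ⊕ v` orthogonal to `H(I) + i^⊕ H(I)` has complex
inner product zero with every test function `f` in `I`. Up to conjugation and a factor 2, this inner
product is a single integral of `f̂ E` over the whole momentum line
(`integral_fourierHat_mul_spectralDensity`). At momentum `-p` with `p > 0`, the density `E` carries
the factors `1 - tanh (β p / 2)` and `1 / cosh (β p / 2)`, which are `O(e^{-β p / 2})`. Hence the
Fourier integral of `f̂ E` extends holomorphically to the strip `0 < Im z < β / 2`. Small translates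
of `f` stay in `I`, so the boundary value vanishes on an interval, therefore everywhere, and `f̂ E =
0` (`ae_eq_zero_of_phase_interval`). Test functions in `I` with `f̂` nonzero on arbitrarily long
intervals give `E = 0`, and the values of `E` at `p` and `-p` determine `u p` and `v p`.

Factoriality rests on two lower bounds for the weight (`le_thermalWeight`). It dominates a positive
constant, so the thermal limit `x` of test functions in `I` is the Fourier transform of some `X` in
`L²(ℝ)` that vanishes off `I`. If `σ(x, g) = 0` for all test functions `g` in `I`, the
distributional derivative of `X` vanishes on `I`, so `X` is a constant `c` there
(`exists_ae_eq_const`). The weight also dominates a multiple of `p`, and the transform of an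
indicator function has modulus squared `2 (1 - cos ((b - a) p)) / p²`; the thermal norm of `x` then
diverges logarithmically unless `c = 0`. -/

/-! ### Uniqueness for boundary values of holomorphic functions on a strip -/

lemma isOpen_strip (a b : ℝ) : IsOpen {z : ℂ | a < z.im ∧ z.im < b} :=
  (isOpen_lt continuous_const Complex.continuous_im).and
    (isOpen_lt Complex.continuous_im continuous_const)

/-- A function holomorphic near a square, and continuous up to the side on the real axis, vanishes
at the centre of the square if it vanishes on that side. -/
lemma eq_zero_of_square {φ : ℂ → ℂ} {r δ : ℝ}
    (hc : ContinuousOn φ {z | 0 ≤ z.im ∧ z.im < r})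
    (hd : DifferentiableOn ℂ φ {z | 0 < z.im ∧ z.im < r})
    (h0 : ∀ t : ℝ, |t| < δ → φ t = 0) {z : ℂ} (hz : 0 < z.im) (hzr : 2 * z.im < r)
    (hzδ : |z.re| + z.im < δ) : φ z = 0 := by
  set d := z.im with hd'
  set U : Set ℂ := Ioo (-d) d ×ℂ Ioo (-d) d with hU
  have hcl : closure U = Icc (-d) d ×ℂ Icc (-d) d := by
    rw [hU, closure_reProdIm, closure_Ioo (by linarith)]
  -- The proof uses the product of `φ (z + c w)` over `c = ±1, ±I` on the square `U` of half-side
  -- `Im z` centred at 0. Each `c` rotates the square onto itself, and each side is turned by one of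
  -- them into the bottom side, where `z + c w` is real and `φ` vanishes. The product is thus zero
  -- on the frontier, so by the maximum principle it is zero at the centre, where it equals `φ z ^
  -- 4`.
  have key : ∀ c : ℂ, (∀ w ∈ closure U, c * w ∈ closure U) → (∀ w ∈ U, c * w ∈ U) →
      DiffContOnCl ℂ (fun w => φ (z + c * w)) U := by
    intro c h1 h2
    refine ⟨hd.comp (by fun_prop) fun w hw => ?_, hc.comp (by fun_prop) fun w hw => ?_⟩
    · have := h2 w hw
      rw [hU, mem_reProdIm] at this
      obtain ⟨_, h3, h4⟩ := this
      simp only [mem_ofPred_eq, add_im]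
      exact ⟨by linarith, by linarith⟩
    · have := h1 w hw
      rw [hcl, mem_reProdIm] at this
      obtain ⟨_, h3, h4⟩ := this
      simp only [mem_ofPred_eq, add_im]
      exact ⟨by linarith, by linarith⟩
  have k1 := key 1 (by simp) (by simp)
  have k2 := key (-1) (by simp only [hcl, mem_reProdIm]; intro w hw; simp at hw ⊢; grind)
    (by simp only [hU, mem_reProdIm]; intro w hw; simp at hw ⊢; grind)
  have k3 := key I (by simp only [hcl, mem_reProdIm]; intro w hw; simp at hw ⊢; grind)
    (by simp only [hU, mem_reProdIm]; intro w hw; simp at hw ⊢; grind)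
  have k4 := key (-I) (by simp only [hcl, mem_reProdIm]; intro w hw; simp at hw ⊢; grind)
    (by simp only [hU, mem_reProdIm]; intro w hw; simp at hw ⊢; grind)
  have hside : ∀ w : ℂ, |w.re| ≤ d → w.im = -d → φ (z + w) = 0 := by
    intro w h1 h2
    have e : z + w = ((z.re + w.re : ℝ) : ℂ) := by
      apply Complex.ext <;> simp [h2, ← hd']
    rw [e]
    exact h0 _ (by linarith [abs_add_le z.re w.re])
  have hb : Bornology.IsBounded U := (Metric.isBounded_Ioo _ _).reProdIm (Metric.isBounded_Ioo _ _)
  have hmul : ∀ {f g : ℂ → ℂ}, DiffContOnCl ℂ f U → DiffContOnCl ℂ g U →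
      DiffContOnCl ℂ (fun w => f w * g w) U := fun hf hg =>
    ⟨hf.1.mul hg.1, hf.2.mul hg.2⟩
  have hz0 := Complex.eqOn_of_eqOn_frontier hb (hmul (hmul k1 k2) (hmul k3 k4))
    (g := fun _ => 0) diffContOnCl_const (fun w hw => ?_)
  · have := hz0 (x := 0) (by rw [hU, mem_reProdIm]; simp; exact hz)
    simpa using this
  · have hw1 : w ∈ closure U := frontier_subset_closure hw
    have hw2 : w ∉ U := by
      have ho : IsOpen U := isOpen_Ioo.reProdIm isOpen_Ioo
      rw [ho.frontier_eq] at hw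
      exact hw.2
    rw [hcl, mem_reProdIm] at hw1
    rw [hU, mem_reProdIm] at hw2
    obtain ⟨⟨a1, a2⟩, a3, a4⟩ := hw1
    have hre : |w.re| ≤ d := abs_le.2 ⟨a1, a2⟩
    have him : |w.im| ≤ d := abs_le.2 ⟨a3, a4⟩
    have hcases : w.im = -d ∨ w.im = d ∨ w.re = -d ∨ w.re = d := by
      by_contra! h
      exact hw2 ⟨⟨lt_of_le_of_ne a1 h.2.2.1.symm, lt_of_le_of_ne a2 h.2.2.2⟩,
        lt_of_le_of_ne a3 h.1.symm, lt_of_le_of_ne a4 h.2.1⟩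
    rcases hcases with h | h | h | h
    · simp [hside w hre h]
    · simp [hside (-w) (by simpa) (by simp [h])]
    · have := hside (I * w) (by simpa) (by simp [h])
      simp [this]
    · have := hside (-(I * w)) (by simpa) (by simp [h])
      simp [this]

/-- A function on a closed half-strip that vanishes on an interval of the edge vanishes on the
whole edge. -/
theorem eq_zero_of_edge {φ : ℂ → ℂ} {r δ : ℝ} (hr : 0 < r) (hδ : 0 < δ)
    (hc : ContinuousOn φ {z | 0 ≤ z.im ∧ z.im < r})
    (hd : DifferentiableOn ℂ φ {z | 0 < z.im ∧ z.im < r})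
    (h0 : ∀ t : ℝ, |t| < δ → φ t = 0) (t : ℝ) : φ t = 0 := by
  have hopen : IsOpen {z : ℂ | 0 < z.im ∧ z.im < r} := isOpen_strip _ _
  have hconv : Convex ℝ {z : ℂ | 0 < z.im ∧ z.im < r} :=
    (convex_halfSpace_im_gt 0).inter (convex_halfSpace_im_lt r)
  set m := min r δ with hm
  have hmpos : 0 < m := lt_min hr hδ
  have hmr : m ≤ r := min_le_left _ _
  have hmδ : m ≤ δ := min_le_right _ _
  -- The point `I * (m / 4)` satisfies the strict inequalities of `eq_zero_of_square`, and so do its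
  -- neighbours; the identity theorem spreads the zero over the open strip, and continuity then
  -- carries it to the edge.
  have hin : EqOn φ 0 {z : ℂ | 0 < z.im ∧ z.im < r} := by
    refine (hd.analyticOnNhd hopen).eqOn_zero_of_preconnected_of_eventuallyEq_zero
      hconv.isPreconnected (z₀ := I * (m / 4 : ℝ)) ?_ ?_
    · simp; constructor <;> linarith
    · have hV : IsOpen {z : ℂ | 0 < z.im ∧ 2 * z.im < r ∧ |z.re| + z.im < δ} := by
        exact (isOpen_lt continuous_const Complex.continuous_im).and
          ((isOpen_lt (continuous_const.mul Complex.continuous_im) continuous_const).and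
            (isOpen_lt (Complex.continuous_re.abs.add Complex.continuous_im) continuous_const))
      filter_upwards [hV.mem_nhds (x := I * (m / 4 : ℝ))
        (by simp; refine ⟨?_, ?_, ?_⟩ <;> linarith)] with z hz
      exact eq_zero_of_square hc hd h0 hz.1 hz.2.1 hz.2.2
  have hcl : (t : ℂ) ∈ closure {z : ℂ | 0 < z.im ∧ z.im < r} := by
    have : {z : ℂ | 0 < z.im ∧ z.im < r} = univ ×ℂ Ioo 0 r := by
      ext z; simp [mem_reProdIm]
    rw [this, closure_reProdIm, closure_Ioo hr.ne, mem_reProdIm]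
    simp [hr.le]
  have hsub : {z : ℂ | 0 < z.im ∧ z.im < r} ⊆ {z | 0 ≤ z.im ∧ z.im < r} :=
    fun z hz => ⟨hz.1.le, hz.2⟩
  have ht := (hc t ⟨by simp, by simpa⟩).mono hsub
  have : (𝓝[{z : ℂ | 0 < z.im ∧ z.im < r}] (t : ℂ)).NeBot := mem_closure_iff_nhdsWithin_neBot.1 hcl
  refine tendsto_nhds_unique (ht.tendsto) ?_
  refine tendsto_const_nhds.congr' ?_
  filter_upwards [self_mem_nhdsWithin] with z hz
  exact (hin hz).symm

/-- If `E` decays exponentially to the left and the Fourier transform of `E` vanishes on an interval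
then `E` vanishes. -/
theorem ae_eq_zero_of_phase_interval {E : ℝ → ℂ} {r δ : ℝ} (hr : 0 < r) (hδ : 0 < δ)
    (hE : Integrable fun p => (1 + Real.exp (-(p * r)) : ℂ) * E p)
    (h : ∀ t : ℝ, |t| < δ → ∫ p, E p * Complex.exp (I * (t * p : ℝ)) = 0) :
    ∀ᵐ p, E p = 0 := by
  have hpos : ∀ p : ℝ, 0 < 1 + Real.exp (-(p * r)) := fun p => by positivity
  have hn : ∀ p : ℝ, ‖(1 + Real.exp (-(p * r)) : ℂ) * E p‖ = (1 + Real.exp (-(p * r))) * ‖E p‖ := by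
    intro p
    rw [norm_mul, ← ofReal_one, ← ofReal_add, norm_real, Real.norm_of_nonneg (hpos p).le]
  have hm : AEStronglyMeasurable E := by
    -- Measurability is given only for the weighted function; division by the positive weight
    -- recovers `E`.
    refine AEStronglyMeasurable.congr (f := fun p : ℝ => (((1 + Real.exp (-(p * r)))⁻¹ : ℝ) : ℂ)
      * ((1 + Real.exp (-(p * r)) : ℂ) * E p)) ?_ (ae_of_all _ fun p => ?_)
    · refine AEStronglyMeasurable.mul ?_ hE.aestronglyMeasurable
      exact (Complex.continuous_ofReal.comp ((by fun_prop : Continuous fun p : ℝ =>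
        1 + Real.exp (-(p * r))).inv₀ fun p => (hpos p).ne')).aestronglyMeasurable
    · have := (hpos p).ne'
      have h1 : (1 + Real.exp (-(p * r)) : ℂ) ≠ 0 := by exact_mod_cast this
      simp only []
      rw [ofReal_inv, ← mul_assoc, ofReal_add, ofReal_one, inv_mul_cancel₀ h1, one_mul]
  have hEn : Integrable fun p => (1 + Real.exp (-(p * r))) * ‖E p‖ :=
    hE.norm.congr (ae_of_all _ hn)
  have hE1 : Integrable E := hEn.mono' hm (ae_of_all _ fun p =>
    le_mul_of_one_le_left (norm_nonneg _) (by linarith [Real.exp_pos (-(p * r))]))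
  -- The exponential is at most `1` for `p ≥ 0` and at most `exp (-(p r))` for `p ≤ 0`; the sum of
  -- the two dominates uniformly over the closed strip.
  have hbound : ∀ (p y : ℝ), 0 ≤ y → y ≤ r → Real.exp (-(p * y)) ≤ 1 + Real.exp (-(p * r)) := by
    intro p y h1 h2
    rcases le_total 0 p with hp | hp
    · have : Real.exp (-(p * y)) ≤ 1 := Real.exp_le_one_iff.2 (by nlinarith)
      linarith [Real.exp_pos (-(p * r))]
    · have : Real.exp (-(p * y)) ≤ Real.exp (-(p * r)) := Real.exp_le_exp.2 (by nlinarith)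
      linarith
  have hnorm : ∀ (p : ℝ) (z : ℂ), ‖Complex.exp (I * z * p)‖ = Real.exp (-(p * z.im)) := by
    intro p z
    rw [Complex.norm_exp]; congr 1; simp [mul_comm]
  have hmeas : ∀ z : ℂ, AEStronglyMeasurable (fun p : ℝ => E p * Complex.exp (I * z * p)) :=
    fun z => hm.mul (by fun_prop)
  have hle : ∀ (p : ℝ) (z : ℂ), 0 ≤ z.im → z.im ≤ r →
      ‖E p * Complex.exp (I * z * p)‖ ≤ (1 + Real.exp (-(p * r))) * ‖E p‖ := by
    intro p z h1 h2
    rw [norm_mul, hnorm, mul_comm]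
    gcongr
    exact hbound p _ h1 h2
  set φ : ℂ → ℂ := fun z => ∫ p, E p * Complex.exp (I * z * p) with hφ
  refine ae_eq_zero_of_phase hE1 fun t => ?_
  have hreal : ∀ t : ℝ, φ t = ∫ p, E p * Complex.exp (I * (t * p : ℝ)) := fun t => by
    simp only [hφ, ofReal_mul, mul_assoc]
  rw [← hreal]
  refine eq_zero_of_edge hr hδ (fun z hz => ?_) (fun z hz => ?_)
    (fun t ht => (hreal t).trans (h t ht)) t
  · refine tendsto_integral_filter_of_dominated_convergence _
      (Eventually.of_forall hmeas) ?_ hEn (ae_of_all _ fun p => ?_)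
    · filter_upwards [self_mem_nhdsWithin] with w hw
      exact ae_of_all _ fun p => hle p w hw.1 hw.2.le
    · have : Continuous fun w : ℂ => E p * Complex.exp (I * w * p) := by fun_prop
      exact (this.tendsto z).mono_left nhdsWithin_le_nhds
  · obtain ⟨hz1, hz2⟩ := hz
    -- The margin pays for the factor `p` produced by differentiation: `|p| ≤ ε⁻¹ exp (ε |p|)`, and
    -- absorbing this exponential shifts `Im w` by `ε`, which stays within the strip.
    obtain ⟨ε, hε, hε1, hε2⟩ : ∃ ε > 0, 2 * ε ≤ z.im ∧ z.im ≤ r - 2 * ε :=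
      ⟨min (z.im / 2) ((r - z.im) / 2), lt_min (by linarith) (by linarith),
        by linarith [min_le_left (z.im / 2) ((r - z.im) / 2)],
        by linarith [min_le_right (z.im / 2) ((r - z.im) / 2)]⟩
    have hopen : IsOpen {w : ℂ | ε < w.im ∧ w.im < r - ε} :=
      isOpen_strip _ _
    refine (hasDerivAt_integral_of_dominated_loc_of_deriv_le (μ := volume)
      (F' := fun w p => E p * (Complex.exp (I * w * p) * (I * p)))
      (bound := fun p => 1 / ε * ((1 + Real.exp (-(p * r))) * ‖E p‖))
      (hopen.mem_nhds ⟨by linarith, by linarith⟩) (Eventually.of_forall hmeas)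
      (hEn.mono' (hmeas z) (ae_of_all _ fun p => hle p z hz1.le hz2.le))
      (hm.mul (by fun_prop)) (ae_of_all _ fun p w hw => ?_) (hEn.const_mul _)
      (ae_of_all _ fun p w _ => ?_)).2.differentiableAt.differentiableWithinAt
    · obtain ⟨hw1, hw2⟩ := hw
      have hp : |p| ≤ 1 / ε * Real.exp (ε * |p|) := by
        have := Real.add_one_le_exp (ε * |p|)
        rw [one_div, inv_mul_eq_div, le_div_iff₀ hε]
        linarith
      have h1 : Real.exp (ε * |p|) * Real.exp (-(p * w.im)) ≤ 1 + Real.exp (-(p * r)) := by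
        rw [← Real.exp_add]
        rcases abs_cases p with ⟨h, _⟩ | ⟨h, _⟩
        · rw [h, show ε * p + -(p * w.im) = -(p * (w.im - ε)) by ring]
          exact hbound p _ (by linarith) (by linarith)
        · rw [h, show ε * -p + -(p * w.im) = -(p * (w.im + ε)) by ring]
          exact hbound p _ (by linarith) (by linarith)
      rw [norm_mul, norm_mul, hnorm, norm_mul, norm_I, one_mul, norm_real, Real.norm_eq_abs]
      calc ‖E p‖ * (Real.exp (-(p * w.im)) * |p|)
          ≤ ‖E p‖ * (Real.exp (-(p * w.im)) * (1 / ε * Real.exp (ε * |p|))) := by gcongr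
        _ = 1 / ε * ((Real.exp (ε * |p|) * Real.exp (-(p * w.im))) * ‖E p‖) := by ring
        _ ≤ _ := by gcongr
    · have h1 : HasDerivAt (fun w : ℂ => I * w * p) (I * p) w := by
        simpa using ((hasDerivAt_id w).const_mul I).mul_const (p : ℂ)
      exact (h1.cexp).const_mul _

/-! ### Test functions in an interval with zero-free Fourier transform -/

lemma fourierHat_comp_affine (f : ℝ → ℝ) {l : ℝ} (hl : 0 < l) (c p : ℝ) :
    fourierHat (fun x => f (l * (x - c))) p
      = Complex.exp (I * (c * p : ℝ)) * ((l⁻¹ : ℝ) * fourierHat f (p / l)) := by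
  unfold fourierHat
  have h := Measure.integral_comp_mul_left
    (fun x : ℝ => Complex.exp (I * x * (p / l : ℝ)) * (f x : ℂ)) l
  rw [abs_of_pos (inv_pos.2 hl), Complex.real_smul] at h
  rw [← h, ← integral_const_mul, ← integral_add_right_eq_self _ c]
  congr 1
  ext x
  simp only [add_sub_cancel_right]
  rw [← mul_assoc, ← Complex.exp_add]
  congr 2
  have : (l : ℂ) ≠ 0 := by exact_mod_cast hl.ne'
  push_cast
  field_simp
  ring

/-- Test functions in an interval, together with their small translates, whose Fourier transform
has no zero in `(0, N)`. -/
lemma exists_local_fourierHat_ne_zero {a b : ℝ} (hab : a < b) {N : ℝ} (hN : 0 < N) :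
    ∃ f : testFunctions (Ioo a b), (∀ p ∈ Ioo 0 N, fourierHat f p ≠ 0) ∧ ∃ δ > 0, ∀ t : ℝ, |t| < δ →
      ∃ g : testFunctions (Ioo a b), ∀ p,
        fourierHat g p = fourierHat f p * Complex.exp (I * (t * p : ℝ)) := by
  obtain ⟨f, hf⟩ := exists_fourierHat_ne_zero 1 one_pos
  obtain ⟨R, hR⟩ := f.2.2.1.isCompact.isBounded.subset_closedBall 0
  set δ := (b - a) / 4 with hδ
  have hδ0 : 0 < δ := by rw [hδ]; linarith
  -- The bound `N < l` puts `p / l` in `(0, 1)`, where `f̂` has no zero. The bound `R / δ < l`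
  -- shrinks the support to within `δ` of its centre `c + t`; as `|t| < δ`, the support is within `2
  -- δ = (b - a) / 2` of the midpoint.
  obtain ⟨l, hlN, hlR⟩ : ∃ l : ℝ, N < l ∧ R / δ < l := by
    obtain ⟨l, hl⟩ := exists_gt (max N (R / δ))
    exact ⟨l, (le_max_left _ _).trans_lt hl, (le_max_right _ _).trans_lt hl⟩
  have hl : 0 < l := hN.trans hlN
  set c := (a + b) / 2 with hc
  have hmem : ∀ t : ℝ, |t| < δ → (fun x => (f : ℝ → ℝ) (l * (x - (c + t)))) ∈
      testFunctions (Ioo a b) := by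
    intro t ht
    set e : ℝ ≃ₜ ℝ := (Homeomorph.subRight (c + t)).trans (Homeomorph.mulLeft₀ l hl.ne') with he
    refine ⟨f.2.1.comp (by fun_prop), f.2.2.1.comp_homeomorph e, fun x hx => ?_⟩
    have h1 : e x ∈ tsupport (f : ℝ → ℝ) := by
      have := tsupport_comp_eq_preimage (f : ℝ → ℝ) e
      exact (Set.ext_iff.1 this x).1 hx
    have h2 := hR h1
    have h3 : e x = l * (x - (c + t)) := rfl
    rw [mem_closedBall_zero_iff, Real.norm_eq_abs, h3, abs_mul, abs_of_pos hl] at h2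
    rw [div_lt_iff₀ hδ0] at hlR
    have h4 : |x - (c + t)| < δ := lt_of_mul_lt_mul_left (h2.trans_lt hlR) hl.le
    rw [abs_lt] at ht h4
    constructor <;> linarith
  refine ⟨⟨_, hmem 0 (by simpa)⟩, fun p hp => ?_, δ, hδ0, fun t ht => ⟨⟨_, hmem t ht⟩, fun p => ?_⟩⟩
  · refine (fourierHat_comp_affine f hl _ p).trans_ne ?_
    refine mul_ne_zero (Complex.exp_ne_zero _) (mul_ne_zero ?_ (hf _ ⟨div_pos hp.1 hl, ?_⟩))
    · exact_mod_cast (inv_pos.2 hl).ne'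
    · rw [div_lt_one hl]; exact hp.2.trans hlN
  · refine (fourierHat_comp_affine f hl _ p).trans ?_
    refine Eq.trans ?_ (congrArg (· * _) (fourierHat_comp_affine f hl _ p).symm)
    rw [mul_right_comm, ← Complex.exp_add]
    congr 2
    push_cast; ring

/-! ### Bounds on the thermal multipliers and the thermal measure -/

lemma thermalWeight_pos {β p : ℝ} (hβ : 0 < β) (hp : 0 < p) : 0 < thermalWeight β p := by
  unfold thermalWeight
  have h1 := Real.cosh_pos (β * p / 2)
  have h2 : 0 < Real.sinh (β * p / 2) := Real.sinh_pos_iff.2 (by positivity)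
  have := Real.pi_pos
  positivity

lemma thermalSech_pos (β p : ℝ) : 0 < thermalSech β p := by
  unfold thermalSech
  have := Real.cosh_pos (β * p / 2)
  positivity

lemma abs_thermalTanh_le_one (β p : ℝ) : |thermalTanh β p| ≤ 1 := by
  refine abs_le_one_iff_mul_self_le_one.2 ?_
  nlinarith [thermalTanh_sq_add β p, sq_nonneg (thermalSech β p)]

lemma abs_thermalSech_le_one (β p : ℝ) : |thermalSech β p| ≤ 1 := by
  refine abs_le_one_iff_mul_self_le_one.2 ?_
  nlinarith [thermalTanh_sq_add β p, sq_nonneg (thermalTanh β p)]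

/-- This decay rate of the purification term is what limits the strip of analyticity to width `β /
2`. -/
lemma exp_mul_thermalSech_le (β p : ℝ) : Real.exp (p * (β / 2)) * thermalSech β p ≤ 2 := by
  unfold thermalSech
  rw [Real.cosh_eq, show p * (β / 2) = β * p / 2 by ring]
  have h1 := Real.exp_pos (β * p / 2)
  have h2 := Real.exp_pos (-(β * p / 2))
  rw [mul_one_div, div_le_iff₀ (by positivity)]
  linarith

/-- One has `1 - tanh y = exp (-y) / cosh y`, which even decays like `exp (-2 y)`; half of that rate
suffices, to match the `sech` term. -/
lemma exp_mul_one_sub_thermalTanh_le {β p : ℝ} (hβ : 0 < β) (hp : 0 < p) :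
    Real.exp (p * (β / 2)) * (1 - thermalTanh β p) ≤ 2 := by
  unfold thermalTanh
  rw [Real.tanh_eq_sinh_div_cosh, one_sub_div (Real.cosh_pos _).ne', Real.cosh_sub_sinh,
    Real.cosh_eq, show p * (β / 2) = β * p / 2 by ring]
  have h0 : 0 < β * p / 2 := by positivity
  have h1 := Real.one_lt_exp_iff.2 h0
  have h2 := Real.exp_pos (-(β * p / 2))
  rw [← mul_div_assoc, ← Real.exp_add, div_le_iff₀ (by positivity)]
  simp
  linarith

lemma absolutelyContinuous_thermalMeasure {β : ℝ} (hβ : 0 < β) :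
    thermalMeasure β ≪ volume.restrict (Ioi 0) ∧ volume.restrict (Ioi 0) ≪ thermalMeasure β := by
  refine ⟨withDensity_absolutelyContinuous _ _,
    withDensity_absolutelyContinuous' (measurable_thermalWeight β).ennreal_ofReal.aemeasurable ?_⟩
  filter_upwards [ae_restrict_mem measurableSet_Ioi] with p hp
  simpa using thermalWeight_pos hβ hp

/-- Integrability against the thermal measure in terms of the Lebesgue measure. -/
lemma integrableOn_thermalWeight_mul {β : ℝ} (hβ : 0 < β) {K : ℝ → ℂ}
    (hK : Integrable K (thermalMeasure β)) :
    IntegrableOn (fun p => (thermalWeight β p : ℂ) * K p) (Ioi 0) := by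
  have h2 := hK
  unfold thermalMeasure at h2
  rw [integrable_withDensity_iff_integrable_smul' (measurable_thermalWeight β).ennreal_ofReal
    (by simp)] at h2
  refine h2.congr ?_
  filter_upwards [ae_restrict_mem measurableSet_Ioi] with p hp
  rw [ENNReal.toReal_ofReal (thermalWeight_pos hβ hp).le, Complex.real_smul]

/-! ### Vectors of the purified space as densities on the momentum line -/

/-- The density in momentum space of `conj (f̂ p) u(p)` for the thermal measure. -/
def thermalSesq (β : ℝ) {U : Set ℝ} (f : testFunctions U) (u : OneParticle β) (p : ℝ) : ℂ :=
  thermalWeight β p * ((starRingEnd ℂ) (fourierHat f p) * u p)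

lemma integrableOn_thermalSesq {β : ℝ} (hβ : 0 < β) {U : Set ℝ} (f : testFunctions U)
    (u : OneParticle β) : IntegrableOn (thermalSesq β f u) (Ioi 0) := by
  refine integrableOn_thermalWeight_mul hβ ?_
  have h1 : Integrable (fun p => inner ℂ (embed β U f p) (u p)) (thermalMeasure β) :=
    L2.integrable_inner (𝕜 := ℂ) (embed β U f) u
  refine h1.congr ?_
  filter_upwards [coeFn_embed β f] with p hp
  rw [hp, RCLike.inner_apply, mul_comm]

lemma inner_embed_eq_integral {β : ℝ} (hβ : 0 < β) {U : Set ℝ} (f : testFunctions U)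
    (u : OneParticle β) :
    inner ℝ (embed β U f) u = ∫ p in Ioi 0, (thermalSesq β f u p).re := by
  rw [L2.inner_def, integral_congr_ae
    (g := fun p => ((starRingEnd ℂ) (fourierHat f p) * u p).re) ?_, integral_thermalMeasure hβ]
  · simp only [thermalSesq, re_ofReal_mul]
  · filter_upwards [coeFn_embed β f] with p hp
    rw [hp, Complex.inner, mul_comm]

/-- The function on the whole momentum line that represents the vector `u ⊕ v` of `ℋ^⊕`. -/
def spectralDensity (β : ℝ) (u v : OneParticle β) (p : ℝ) : ℂ :=
  if 0 < p then (starRingEnd ℂ)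
    (thermalWeight β p * ((1 + thermalTanh β p) * u p - thermalSech β p * v p))
  else thermalWeight β (-p) * ((1 - thermalTanh β (-p)) * u (-p) + thermalSech β (-p) * v (-p))

lemma fourierHat_mul_spectralDensity_of_pos {β : ℝ} {U : Set ℝ} (f : testFunctions U)
    (u v : OneParticle β) {p : ℝ} (hp : 0 < p) :
    fourierHat f p * spectralDensity β u v p = (starRingEnd ℂ)
      ((1 + thermalTanh β p) * thermalSesq β f u p - thermalSech β p * thermalSesq β f v p) := by
  rw [spectralDensity, if_pos hp, thermalSesq, thermalSesq]
  simp only [map_mul, map_sub, map_add, conj_conj]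
  ring

lemma fourierHat_mul_spectralDensity_neg_of_pos {β : ℝ} {U : Set ℝ} (f : testFunctions U)
    (u v : OneParticle β) {p : ℝ} (hp : 0 < p) :
    fourierHat f (-p) * spectralDensity β u v (-p) =
      (1 - thermalTanh β p) * thermalSesq β f u p + thermalSech β p * thermalSesq β f v p := by
  rw [spectralDensity, if_neg (by linarith), neg_neg, thermalSesq, thermalSesq, conj_fourierHat]
  ring

lemma integrableOn_mul_thermalSesq {β : ℝ} (hβ : 0 < β) {U : Set ℝ} (f : testFunctions U)
    (u : OneParticle β) {m : ℝ → ℝ} (hm : Measurable m) {C : ℝ} (hC : ∀ p, 0 < p → |m p| ≤ C) :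
    IntegrableOn (fun p => (m p : ℂ) * thermalSesq β f u p) (Ioi 0) := by
  refine Integrable.bdd_mul (c := C) (integrableOn_thermalSesq hβ f u)
    (measurable_ofReal.comp hm).aestronglyMeasurable ?_
  filter_upwards [ae_restrict_mem measurableSet_Ioi] with p hp
  rw [norm_real]
  exact hC p hp

/-- This is the hypothesis of `ae_eq_zero_of_phase_interval` with `r = β / 2`. At positive momenta
the exponential is at most 1 and the multipliers are bounded. At negative momenta the exponential
grows, and the decay of `1 - tanh` and `sech` compensates it. -/
lemma integrable_exp_mul_spectralDensity {β : ℝ} (hβ : 0 < β) {U : Set ℝ} (f : testFunctions U)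
    (u v : OneParticle β) :
    Integrable fun p => (1 + Real.exp (-(p * (β / 2))) : ℂ) *
      (fourierHat f p * spectralDensity β u v p) := by
  have ht := measurable_thermalTanh β
  have hs := measurable_thermalSech β
  refine (integrable_fold ?_ ?_).1
  · have h1 := integrableOn_mul_thermalSesq hβ f u
      (m := fun p => (1 + Real.exp (-(p * (β / 2)))) * (1 + thermalTanh β p)) (by fun_prop)
      (C := 2 * 2) fun p hp => by
        have h1 : Real.exp (-(p * (β / 2))) ≤ 1 := Real.exp_le_one_iff.2 (by
          have : 0 < p * (β / 2) := by positivity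
          linarith)
        have h2 := Real.exp_pos (-(p * (β / 2)))
        rw [abs_mul, abs_of_pos (by linarith)]
        gcongr
        · linarith
        · have := abs_le.1 (abs_thermalTanh_le_one β p)
          rw [abs_le]; constructor <;> linarith
    have h2 := integrableOn_mul_thermalSesq hβ f v
      (m := fun p => (1 + Real.exp (-(p * (β / 2)))) * thermalSech β p) (by fun_prop)
      (C := 2 * 1) fun p hp => by
        have h1 : Real.exp (-(p * (β / 2))) ≤ 1 := Real.exp_le_one_iff.2 (by
          have : 0 < p * (β / 2) := by positivity
          linarith)
        have h2 := Real.exp_pos (-(p * (β / 2)))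
        rw [abs_mul, abs_of_pos (by linarith)]
        gcongr
        · linarith
        · exact abs_thermalSech_le_one β p
    refine IntegrableOn.congr_fun
      (Complex.conjCLE.toContinuousLinearMap.integrable_comp (h1.sub h2))
      (fun p hp => ?_) measurableSet_Ioi
    rw [fourierHat_mul_spectralDensity_of_pos f u v hp]
    simp [← Complex.exp_conj, map_ofNat]
    ring
  · have h1 := integrableOn_mul_thermalSesq hβ f u
      (m := fun p => (1 + Real.exp (p * (β / 2))) * (1 - thermalTanh β p)) (by fun_prop)
      (C := 4) fun p hp => by
        have h1 := exp_mul_one_sub_thermalTanh_le hβ hp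
        have h2 := Real.exp_pos (p * (β / 2))
        have h3 := abs_le.1 (abs_thermalTanh_le_one β p)
        rw [abs_of_nonneg (mul_nonneg (by linarith) (by linarith))]
        linarith
    have h2 := integrableOn_mul_thermalSesq hβ f v
      (m := fun p => (1 + Real.exp (p * (β / 2))) * thermalSech β p) (by fun_prop)
      (C := 4) fun p hp => by
        have h1 := exp_mul_thermalSech_le β p
        have h2 := Real.exp_pos (p * (β / 2))
        have h3 := abs_le.1 (abs_thermalSech_le_one β p)
        have h4 := thermalSech_pos β p
        rw [abs_of_nonneg (mul_nonneg (by linarith) (by linarith))]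
        linarith
    refine IntegrableOn.congr_fun (h1.add h2) (fun p hp => ?_) measurableSet_Ioi
    rw [fourierHat_mul_spectralDensity_neg_of_pos f u v hp]
    simp
    ring

lemma inner_mk_zero_left {β : ℝ} (x u v : OneParticle β) :
    inner ℂ (Purified.mk x 0) (Purified.mk u v)
      = ⟨inner ℝ x u, inner ℝ x (opD β u - opC β (opR β v))⟩ := by
  rw [Purified.inner_def]
  congr 1
  · rw [WithLp.prod_inner_apply]
    change inner ℝ x u + inner ℝ (0 : OneParticle β) v = _
    simp
  · rw [inner_neg_right, WithLp.prod_inner_apply]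
    change -(inner ℝ x (-(opD β u) + opC β (opR β v)) + inner ℝ (0 : OneParticle β) _) = _
    rw [inner_zero_left, add_zero, ← inner_neg_right]
    congr 1
    abel

/-- Put `A = ∫ F_u` and `B = ∫ (tanh · F_u - sech · F_v)` over `p > 0`, where `F` denotes
`thermalSesq`. The inner product is `Re A + i Im B`, so twice its conjugate is `conj (A + B) + (A -
B)`. Since `f` is real, `conj (f̂ p) = f̂ (-p)`, and the two summands are the contributions of the
positive and the negative momenta; this dictates the form of `spectralDensity`. -/
lemma integral_fourierHat_mul_spectralDensity {β : ℝ} (hβ : 0 < β) {U : Set ℝ}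
    (f : testFunctions U) (u v : OneParticle β) :
    ∫ p, fourierHat f p * spectralDensity β u v p
      = 2 * (starRingEnd ℂ) (inner ℂ (Purified.mk (embed β U f) 0) (Purified.mk u v)) := by
  have ht := measurable_thermalTanh β
  have hs := measurable_thermalSech β
  have i1 := integrableOn_thermalSesq hβ f u
  have i3 := integrableOn_mul_thermalSesq hβ f v hs (C := 1) fun p _ => abs_thermalSech_le_one β p
  have i4 : IntegrableOn (fun p => (1 + thermalTanh β p : ℂ) * thermalSesq β f u p
      - thermalSech β p * thermalSesq β f v p) (Ioi 0) := by
    refine Integrable.sub ?_ i3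
    refine (integrableOn_mul_thermalSesq hβ f u (m := fun p => 1 + thermalTanh β p) (by fun_prop)
      (C := 2) fun p _ => ?_).congr_fun (fun p _ => by simp) measurableSet_Ioi
    have := abs_le.1 (abs_thermalTanh_le_one β p)
    rw [abs_le]; constructor <;> linarith
  have i5 : IntegrableOn (fun p => (1 - thermalTanh β p : ℂ) * thermalSesq β f u p
      + thermalSech β p * thermalSesq β f v p) (Ioi 0) := by
    refine Integrable.add ?_ i3
    refine (integrableOn_mul_thermalSesq hβ f u (m := fun p => 1 - thermalTanh β p) (by fun_prop)
      (C := 2) fun p _ => ?_).congr_fun (fun p _ => by simp) measurableSet_Ioi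
    have := abs_le.1 (abs_thermalTanh_le_one β p)
    rw [abs_le]; constructor <;> linarith
  have i6 : IntegrableOn (fun p => (starRingEnd ℂ) ((1 + thermalTanh β p : ℂ) * thermalSesq β f u p
      - thermalSech β p * thermalSesq β f v p)) (Ioi 0) :=
    Complex.conjCLE.toContinuousLinearMap.integrable_comp i4
  rw [(integrable_fold
    (i6.congr_fun (fun p hp => (fourierHat_mul_spectralDensity_of_pos f u v hp).symm)
      measurableSet_Ioi)
    (i5.congr_fun (fun p hp => (fourierHat_mul_spectralDensity_neg_of_pos f u v hp).symm)
      measurableSet_Ioi)).2,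
    setIntegral_congr_fun measurableSet_Ioi
      (fun p hp => fourierHat_mul_spectralDensity_of_pos f u v hp),
    setIntegral_congr_fun measurableSet_Ioi
      (fun p hp => fourierHat_mul_spectralDensity_neg_of_pos f u v hp),
    ← integral_add i6 i5, inner_mk_zero_left]
  apply Complex.ext
  · refine (reCLM.integral_comp_comm (Integrable.add i6 i5)).symm.trans ?_
    rw [inner_embed_eq_integral hβ]
    simp only [mul_re, re_ofNat, im_ofNat, zero_mul, sub_zero, conj_re]
    rw [← integral_const_mul]
    congr 1
    ext p
    simp
    ring
  · refine (imCLM.integral_comp_comm (Integrable.add i6 i5)).symm.trans ?_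
    rw [inner_embed_eq_integral hβ f (opD β u - opC β (opR β v))]
    simp only [mul_im, re_ofNat, im_ofNat, zero_mul, add_zero, conj_im]
    rw [← integral_neg, ← integral_const_mul]
    refine integral_congr_ae ?_
    have hac := (absolutelyContinuous_thermalMeasure hβ).2
    filter_upwards [hac.ae_le (Lp.coeFn_sub (opD β u) (opC β (opR β v))),
      hac.ae_le (coeFn_mulOp β _ (memLp_const_I β) (opAbsD β u)),
      hac.ae_le (coeFn_mulOp β _ (memLp_tanh β) u),
      hac.ae_le (coeFn_mulOp β _ (memLp_const_I β) (opR β v)),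
      hac.ae_le (coeFn_mulOp β _ (memLp_sech β) v)] with p h1 h2 h3 h4 h5
    have e1 : opD β u p = -I * (thermalTanh β p * u p) := by
      refine h2.trans ?_
      rw [← h3]; rfl
    have e2 : opC β (opR β v) p = -I * (thermalSech β p * v p) := by
      refine h4.trans ?_
      rw [← h5]; rfl
    simp only [thermalSesq]
    rw [h1, Pi.sub_apply, e1, e2]
    simp
    ring

/-! ### The Reeh-Schlieder property -/

/-- The Reeh-Schlieder property: a vector orthogonal to the test functions in an interval is
zero. -/
theorem eq_zero_of_inner_embed_eq_zero {β : ℝ} (hβ : 0 < β) {a b : ℝ} (hab : a < b)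
    (u v : OneParticle β)
    (h : ∀ f : testFunctions (Ioo a b),
      inner ℂ (Purified.mk (embed β (Ioo a b) f) 0) (Purified.mk u v) = 0) : u = 0 ∧ v = 0 := by
  have hmain : ∀ n : ℕ, ∀ᵐ p : ℝ, p ∈ Ioo (0 : ℝ) (n + 1) →
      spectralDensity β u v p = 0 ∧ spectralDensity β u v (-p) = 0 := by
    intro n
    -- One `f` is known to have a zero-free transform only on a bounded interval, so the density is
    -- killed on `(0, n + 1)` and its reflection for each `n`.
    obtain ⟨f, hf, δ, hδ, hft⟩ := exists_local_fourierHat_ne_zero hab (N := n + 1) (by positivity)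
    have hz := ae_eq_zero_of_phase_interval (r := β / 2) (by positivity) hδ
      (integrable_exp_mul_spectralDensity hβ f u v) fun t ht => by
        -- The phase turns `f̂` into the transform of a translate that still lies in the interval,
        -- so the hypothesis applies to it.
        obtain ⟨g, hg⟩ := hft t ht
        have h1 := integral_fourierHat_mul_spectralDensity hβ g u v
        rw [h g, map_zero, mul_zero] at h1
        rw [← h1]
        congr 1
        ext p
        rw [hg]; ring
    have hz' := (Measure.measurePreserving_neg (volume : Measure ℝ)).quasiMeasurePreserving.ae hz
    filter_upwards [hz, hz'] with p h1 h2 hp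
    have hne := hf p hp
    refine ⟨(mul_eq_zero.1 h1).resolve_left hne, (mul_eq_zero.1 h2).resolve_left ?_⟩
    rw [← conj_fourierHat]
    simpa using hne
  have hall : ∀ᵐ p ∂(volume.restrict (Ioi (0 : ℝ))), u p = 0 ∧ v p = 0 := by
    filter_upwards [ae_restrict_of_ae (ae_all_iff.2 hmain), ae_restrict_mem measurableSet_Ioi]
      with p h1 hp
    obtain ⟨n, hn⟩ := exists_nat_gt p
    obtain ⟨h2, h3⟩ := h1 n ⟨hp, by linarith⟩
    have hp : 0 < p := hp
    have hw : (thermalWeight β p : ℂ) ≠ 0 := by exact_mod_cast (thermalWeight_pos hβ hp).ne'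
    have hs : (thermalSech β p : ℂ) ≠ 0 := by exact_mod_cast (thermalSech_pos β p).ne'
    rw [spectralDensity, if_pos hp, map_eq_zero] at h2
    rw [spectralDensity, if_neg (by linarith), neg_neg] at h3
    have h2 := (mul_eq_zero.1 h2).resolve_left hw
    have h3 := (mul_eq_zero.1 h3).resolve_left hw
    -- The two relations are `(1 + tanh) u - sech v = 0` and `(1 - tanh) u + sech v = 0`; their sum
    -- is `2 u = 0`, and then `sech ≠ 0` gives `v = 0`.
    have hu : u p = 0 := by linear_combination (h2 + h3) / 2
    rw [hu, mul_zero, zero_add] at h3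
    exact ⟨hu, (mul_eq_zero.1 h3).resolve_left hs⟩
  have hac := (absolutelyContinuous_thermalMeasure hβ).1
  constructor
  · apply Lp.ext
    filter_upwards [hac.ae_le hall, Lp.coeFn_zero ℂ 2 (thermalMeasure β)] with p h1 h2
    rw [h1.1, h2]; rfl
  · apply Lp.ext
    filter_upwards [hac.ae_le hall, Lp.coeFn_zero ℂ 2 (thermalMeasure β)] with p h1 h2
    rw [h1.2, h2]; rfl

/-! ### Comparison of the thermal norm with the norm of `L²(ℝ)` -/

/-- The weight is `(boseWeight β p + boseWeight β (-p)) / π` with nonnegative terms, and the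
denominator `1 - exp (-(β p))` of the first is at most both `1` and `β p`. The linear bound makes
the norm of a jump diverge at large momenta; the constant bound gives control of the `L²(ℝ)` norm.
-/
lemma le_thermalWeight {β p : ℝ} (hβ : 0 < β) (hp : 0 < p) :
    p / Real.pi ≤ thermalWeight β p ∧ 1 / (β * Real.pi) ≤ thermalWeight β p := by
  have hpi := Real.pi_pos
  have hb := (boseWeight_pos_bound hβ hp).1
  have hneg : 0 ≤ boseWeight β (-p) := by
    rw [boseWeight_neg']
    exact mul_nonneg hb (Real.exp_pos _).le
  have h0 : 0 < β * p := mul_pos hβ hp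
  have h1 : Real.exp (-(β * p)) < 1 := Real.exp_lt_one_iff.2 (by linarith)
  have h2 := Real.exp_pos (-(β * p))
  have h3 := Real.add_one_le_exp (-(β * p))
  rw [(thermalWeight_eq hβ hp).1, ← div_div]
  have h4 : p ≤ boseWeight β p := by
    unfold boseWeight
    rw [le_div_iff₀ (by linarith)]
    nlinarith
  have h5 : 1 / β ≤ boseWeight β p := by
    unfold boseWeight
    rw [div_le_div_iff₀ hβ (by linarith)]
    linarith
  constructor <;> gcongr <;> linarith

lemma norm_sq_eq_integral {β : ℝ} (hβ : 0 < β) (u : OneParticle β) :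
    IntegrableOn (fun p => thermalWeight β p * ‖u p‖ ^ 2) (Ioi 0) ∧
    ‖u‖ ^ 2 = ∫ p in Ioi 0, thermalWeight β p * ‖u p‖ ^ 2 := by
  constructor
  · refine (integrableOn_thermalWeight_mul hβ (L2.integrable_inner (𝕜 := ℂ) u u)).re.congr
      (ae_of_all _ fun p => ?_)
    simp only [inner_self_eq_norm_sq_to_K]
    simp only [coe_algebraMap, ← ofReal_pow, ← ofReal_mul]
    rfl
  · rw [← real_inner_self_eq_norm_sq, L2.inner_def]
    simp only [real_inner_self_eq_norm_sq]
    exact integral_thermalMeasure hβ _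

/-- The norm of `L²(ℝ)` is bounded by the thermal norm. -/
lemma norm_toLp_toSchwartz_sq_le {β : ℝ} (hβ : 0 < β) {U : Set ℝ} (f : testFunctions U) :
    ‖(toSchwartz f).toLp 2‖ ^ 2 ≤ β * ‖embed β U f‖ ^ 2 := by
  have hpi := Real.pi_pos
  have h1 : ‖(toSchwartz f).toLp 2‖ ^ 2 = ∫ x, ‖toSchwartz f x‖ ^ 2 := by
    rw [← real_inner_self_eq_norm_sq, L2.inner_def]
    refine integral_congr_ae ?_
    filter_upwards [(toSchwartz f).coeFn_toLp 2 volume] with x hx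
    rw [hx, real_inner_self_eq_norm_sq]
  have h2 : ∫ ξ, ‖FourierTransform.fourier (toSchwartz f) ξ‖ ^ 2
      = (2 * Real.pi)⁻¹ * ∫ p, ‖fourierHat f p‖ ^ 2 := by
    have h := Measure.integral_comp_mul_left (fun p => ‖fourierHat f p‖ ^ 2) (-(2 * Real.pi))
    rw [abs_inv, abs_neg, abs_of_pos (by positivity : 0 < 2 * Real.pi), smul_eq_mul] at h
    rw [← h]
    congr 1
    ext ξ
    rw [fourierHat_eq]
    congr 3
    field_simp
  have hc : Integrable (fun p => ‖fourierHat f p‖ ^ 2) := by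
    have := ((schwartzHat f).memLp 2 volume).integrable_norm_pow (by simp)
    simpa only [schwartzHat_apply] using this
  have h3 : ∫ p, ‖fourierHat f p‖ ^ 2 = 2 * ∫ p in Ioi 0, ‖fourierHat f p‖ ^ 2 := by
    have h4 : ∫ p in Iic 0, ‖fourierHat f p‖ ^ 2 = ∫ p in Ioi 0, ‖fourierHat f p‖ ^ 2 := by
      have := integral_comp_neg_Ioi 0 (fun p => ‖fourierHat f p‖ ^ 2)
      rw [neg_zero] at this
      rw [← this]
      congr 1
      ext p
      rw [← conj_fourierHat, RCLike.norm_conj]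
    rw [← intervalIntegral.integral_Iic_add_Ioi hc.integrableOn hc.integrableOn, h4]
    ring
  have h5 : ∫ p in Ioi 0, 1 / (β * Real.pi) * ‖fourierHat f p‖ ^ 2 ≤ ‖embed β U f‖ ^ 2 := by
    obtain ⟨i1, e1⟩ := norm_sq_eq_integral hβ (embed β U f)
    rw [e1]
    refine integral_mono_ae (hc.integrableOn.const_mul _) i1 ?_
    filter_upwards [(absolutelyContinuous_thermalMeasure hβ).2.ae_le (coeFn_embed β f),
      ae_restrict_mem measurableSet_Ioi] with p h6 hp
    rw [h6]
    gcongr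
    exact (le_thermalWeight hβ hp).2
  rw [integral_const_mul] at h5
  rw [h1, ← SchwartzMap.integral_norm_sq_fourier, h2, h3]
  -- Plancherel and the evenness of `|f̂|` leave the factor `1 / π` on the half-line; compared with
  -- the lower bound `1 / (β π)` of the weight, it yields the constant `β`.
  calc (2 * Real.pi)⁻¹ * (2 * ∫ p in Ioi 0, ‖fourierHat f p‖ ^ 2)
      = β * (1 / (β * Real.pi) * ∫ p in Ioi 0, ‖fourierHat f p‖ ^ 2) := by field_simp
    _ ≤ _ := by gcongr

lemma toSchwartz_sub {U : Set ℝ} (f g : testFunctions U) :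
    toSchwartz (f - g) = toSchwartz f - toSchwartz g := by
  ext x; simp [toSchwartz_apply]

/-- A thermal limit of test functions is also a limit in `L²(ℝ)`. -/
lemma exists_tendsto_toLp {β : ℝ} (hβ : 0 < β) {U : Set ℝ} {x : OneParticle β}
    (hx : x ∈ localSpace β U) :
    ∃ (f : ℕ → testFunctions U) (X : Lp ℂ 2 (volume : Measure ℝ)),
      Tendsto (fun n => embed β U (f n)) atTop (𝓝 x) ∧
      Tendsto (fun n => (toSchwartz (f n)).toLp 2) atTop (𝓝 X) := by
  have hx' : x ∈ closure (LinearMap.range (embed β U) : Set (OneParticle β)) := hx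
  obtain ⟨y, hy, hyx⟩ := mem_closure_iff_seq_limit.1 hx'
  choose f hf using hy
  obtain rfl : (fun n => embed β U (f n)) = y := funext hf
  have hC : CauchySeq fun n => (toSchwartz (f n)).toLp 2 (volume : Measure ℝ) := by
    have h1 := hyx.cauchySeq
    rw [Metric.cauchySeq_iff] at h1 ⊢
    intro ε hε
    have hs : 0 < Real.sqrt β := Real.sqrt_pos.2 hβ
    -- By `norm_toLp_toSchwartz_sq_le`, passing from the thermal norm to the `L²` norm costs at most
    -- a factor `√β`.
    obtain ⟨N, hN⟩ := h1 (ε / Real.sqrt β) (by positivity)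
    refine ⟨N, fun m hm n hn => ?_⟩
    have h2 := hN m hm n hn
    rw [dist_eq_norm, ← map_sub, lt_div_iff₀ hs] at h2
    have h3 : dist ((toSchwartz (f m)).toLp 2 (volume : Measure ℝ)) ((toSchwartz (f n)).toLp 2)
        = ‖(toSchwartz (f m - f n)).toLp 2 (volume : Measure ℝ)‖ := by
      rw [dist_eq_norm, toSchwartz_sub]
      exact congrArg norm (map_sub (SchwartzMap.toLpCLM ℝ ℂ 2 (volume : Measure ℝ)) _ _).symm
    rw [h3]
    refine lt_of_le_of_lt ?_ h2
    refine le_of_sq_le_sq ?_ (by positivity)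
    rw [mul_pow, Real.sq_sqrt hβ.le, mul_comm]
    exact norm_toLp_toSchwartz_sq_le hβ _
  obtain ⟨X, hX⟩ := cauchySeq_tendsto_of_complete hC
  exact ⟨f, X, hyx, hX⟩

/-- Integration against `k` is the inner product with the class of `conj k`, hence continuous on
`L²`. -/
lemma tendsto_integral_mul {F : ℕ → Lp ℂ 2 (volume : Measure ℝ)} {X : Lp ℂ 2 (volume : Measure ℝ)}
    (hF : Tendsto F atTop (𝓝 X)) {k : ℝ → ℂ} (hk : MemLp k 2) :
    Tendsto (fun n => ∫ x, k x * F n x) atTop (𝓝 (∫ x, k x * X x)) := by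
  have h : ∀ Y : Lp ℂ 2 (volume : Measure ℝ),
      inner ℂ (hk.star.toLp _) Y = ∫ x, k x * Y x := by
    intro Y
    rw [L2.inner_def]
    refine integral_congr_ae ?_
    filter_upwards [hk.star.coeFn_toLp] with x hx
    rw [hx, RCLike.inner_apply, mul_comm]
    simp
  simp only [← h]
  exact tendsto_const_nhds.inner hF

/-! ### Functions with vanishing derivative on an interval -/

/-- A locally integrable function whose distributional derivative vanishes on an interval is
constant there. -/
lemma exists_ae_eq_const {X : ℝ → ℂ} (hX : LocallyIntegrable X) {a b : ℝ} (hab : a < b)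
    (h : ∀ g : testFunctions (Ioo a b), ∫ x, ((deriv (g : ℝ → ℝ) x : ℝ) : ℂ) * X x = 0) :
    ∃ c : ℂ, ∀ᵐ x, x ∈ Ioo a b → X x = c := by
  set m := (a + b) / 2 with hm
  let φ : ContDiffBump m := ⟨(b - a) / 8, (b - a) / 4, by linarith, by linarith⟩
  set η : ℝ → ℝ := φ.normed volume with hη
  have hηs : tsupport η ⊆ Ioo a b := by
    rw [hη, φ.tsupport_normed_eq, Real.closedBall_eq_Icc]
    change Icc (m - (b - a) / 4) (m + (b - a) / 4) ⊆ _
    exact Icc_subset_Ioo (by linarith) (by linarith)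
  have hηc : HasCompactSupport η := φ.hasCompactSupport_normed
  have hηd : ContDiff ℝ ∞ η := φ.contDiff_normed
  have hint : ∀ k : ℝ → ℝ, ContDiff ℝ ∞ k → HasCompactSupport k →
      Integrable fun x => (k x : ℂ) * X x := fun k h1 h2 => by
    have := hX.integrable_smul_left_of_hasCompactSupport h1.continuous h2
    simpa only [Complex.real_smul] using this
  -- The bump `η` has total mass 1, so a function constant on the interval must have this value
  -- there.
  set c : ℂ := ∫ x, (η x : ℂ) * X x with hc
  refine ⟨c, ?_⟩
  have hXc : LocallyIntegrable fun x => X x - c := hX.sub (locallyIntegrable_const c)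
  have := isOpen_Ioo.ae_eq_zero_of_integral_contDiff_smul_eq_zero (U := Ioo a b)
    (hXc.locallyIntegrableOn _) fun k h1 h2 h3 => ?_
  · filter_upwards [this] with x hx hx'
    exact sub_eq_zero.1 (hx hx')
  set A := ∫ x, k x with hA
  have hki : Integrable k := h1.continuous.integrable_of_hasCompactSupport h2
  have hηi : Integrable η := φ.integrable_normed
  -- Subtracting `A η` makes the total integral zero. The primitive `g` of `q` then vanishes on both
  -- sides of the support of `q`, so it is a test function in the interval with derivative `q`, and
  -- the hypothesis applies to it.
  set q : ℝ → ℝ := fun x => k x - A * η x with hq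
  have hqd : ContDiff ℝ ∞ q := h1.sub (contDiff_const.mul hηd)
  have hqc : HasCompactSupport q := h2.sub (hηc.mul_left)
  have hq0 : ∫ x, q x = 0 := by
    rw [hq, integral_sub hki (hηi.const_mul _), integral_const_mul, hη, φ.integral_normed]
    simp [hA]
  have hqs : tsupport q ⊆ Ioo a b :=
    (tsupport_sub k _).trans (union_subset h3 ((tsupport_mul_subset_right).trans hηs))
  obtain ⟨a', b', ha', hb', hab', hqs'⟩ : ∃ a' b', a < a' ∧ b' < b ∧ a' ≤ b' ∧
      tsupport q ⊆ Icc a' b' := by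
    -- Adding the midpoint keeps the set nonempty when `q = 0`, so that its infimum and supremum
    -- belong to it.
    have hK : IsCompact (insert m (tsupport q)) := hqc.isCompact.insert m
    have hK0 : (insert m (tsupport q)).Nonempty := insert_nonempty _ _
    have hKs : insert m (tsupport q) ⊆ Ioo a b :=
      insert_subset ⟨by linarith, by linarith⟩ hqs
    refine ⟨sInf (insert m (tsupport q)), sSup (insert m (tsupport q)),
      (hKs (hK.sInf_mem hK0)).1, (hKs (hK.sSup_mem hK0)).2,
      Real.sInf_le_sSup _ hK.bddBelow hK.bddAbove, fun x hx => ?_⟩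
    have hx' := mem_insert_of_mem m hx
    exact ⟨csInf_le hK.bddBelow hx', le_csSup hK.bddAbove hx'⟩
  have hqz : ∀ x, x ∉ Icc a' b' → q x = 0 := fun x hx =>
    image_eq_zero_of_notMem_tsupport fun h => hx (hqs' h)
  set g : ℝ → ℝ := fun x => ∫ y in a'..x, q y with hg
  have hgd : ∀ x, HasDerivAt g (q x) x := fun x =>
    (hqd.continuous.integral_hasStrictDerivAt a' x).hasDerivAt
  have hgz : ∀ x, x ∉ Icc a' b' → g x = 0 := by
    intro x hx
    rcases lt_or_ge x a' with h5 | h5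
    · refine intervalIntegral.integral_zero_ae ?_
      have : ∀ᵐ y : ℝ, y ≠ a' := by simp [ae_iff]
      filter_upwards [this] with y hy hy'
      rw [uIoc_of_ge h5.le] at hy'
      exact hqz y fun h => hy (le_antisymm hy'.2 h.1)
    · have h6 : b' < x := by
        by_contra! h6
        exact hx ⟨h5, h6⟩
      simp only [hg]
      -- To the right of `b'` the primitive is the integral of `q` over the whole line.
      rw [intervalIntegral.integral_of_le h5, setIntegral_eq_integral_of_ae_compl_eq_zero, hq0]
      have : ∀ᵐ y : ℝ, y ≠ a' := by simp [ae_iff]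
      filter_upwards [this] with y hy hy'
      refine hqz y fun h => hy' ⟨lt_of_le_of_ne h.1 hy.symm, h.2.trans h6.le⟩
  have hderiv : deriv g = q := funext fun x => (hgd x).deriv
  have hgs : Function.support g ⊆ Icc a' b' := fun x hx => by
    by_contra h
    exact hx (hgz x h)
  have hgts : tsupport g ⊆ Icc a' b' := closure_minimal hgs isClosed_Icc
  have hmem : g ∈ testFunctions (Ioo a b) := by
    refine ⟨contDiff_infty_iff_deriv.2 ⟨fun x => (hgd x).differentiableAt, by rwa [hderiv]⟩,
      HasCompactSupport.of_support_subset_isCompact isCompact_Icc hgs,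
      hgts.trans (Icc_subset_Ioo ha' hb')⟩
  have h7 := h ⟨g, hmem⟩
  simp only [hderiv] at h7
  have h8 : ∀ x, (q x : ℂ) * X x = (k x : ℂ) * X x - A * ((η x : ℂ) * X x) := fun x => by
    simp only [hq]; push_cast; ring
  simp only [h8] at h7
  rw [integral_sub (hint k h1 h2) ((hint η hηd hηc).const_mul _), integral_const_mul] at h7
  have h9 : ∀ x, k x • (X x - c) = (k x : ℂ) * X x - (k x : ℂ) * c := fun x => by
    rw [Complex.real_smul]; ring
  simp only [h9]
  have hkc : Integrable fun x => (k x : ℂ) * c := hki.ofReal.mul_const c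
  rw [integral_sub (hint k h1 h2) hkc, integral_mul_const,
    integral_complex_ofReal]
  exact h7

lemma integral_mul_toLp {U : Set ℝ} (f : testFunctions U) (k : ℝ → ℂ) :
    ∫ x, k x * (toSchwartz f).toLp 2 (volume : Measure ℝ) x
      = ∫ x, k x * ((f : ℝ → ℝ) x : ℂ) := by
  refine integral_congr_ae ?_
  filter_upwards [(toSchwartz f).coeFn_toLp 2 volume] with x hx
  rw [hx, toSchwartz_apply]

/-- A shift by the half-period `s = π / L` changes the sign of the cosine, so the values of the
integrand at `p` and `p + s` add up to at least `2 / (p + s)`, which is not integrable at infinity.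
-/
lemma not_integrableOn_one_sub_cos_div {L : ℝ} (hL : 0 < L) :
    ¬ IntegrableOn (fun p : ℝ => (1 - Real.cos (L * p)) / p) (Ioi 0) := by
  intro h
  set s := Real.pi / L with hs
  have hs0 : 0 < s := div_pos Real.pi_pos hL
  have mp : MeasurePreserving (fun p : ℝ => p + s) := measurePreserving_add_right volume s
  have me : MeasurableEmbedding (fun p : ℝ => p + s) := measurableEmbedding_addRight s
  have hpre : (fun p : ℝ => p + s) ⁻¹' Ioi s = Ioi 0 := by ext p; simp
  have h1 : IntegrableOn (fun p : ℝ => (1 - Real.cos (L * (p + s))) / (p + s)) (Ioi 0) := by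
    have := (mp.integrableOn_comp_preimage me (s := Ioi s)).2
      (h.mono_set (Ioi_subset_Ioi hs0.le))
    rwa [hpre] at this
  have h2 : IntegrableOn (fun p : ℝ => (p + s)⁻¹) (Ioi 0) := by
    refine Integrable.mono' (Integrable.add h h1) (by fun_prop) ?_
    filter_upwards [ae_restrict_mem measurableSet_Ioi] with p hp
    have hp : 0 < p := hp
    have e : L * (p + s) = L * p + Real.pi := by rw [hs]; field_simp
    have h3 : (1 - Real.cos (L * p)) / (p + s) ≤ (1 - Real.cos (L * p)) / p :=
      div_le_div_of_nonneg_left (by linarith [Real.cos_le_one (L * p)]) hp (by linarith)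
    rw [Real.norm_of_nonneg (by positivity), Pi.add_apply, e, Real.cos_add_pi]
    refine le_trans ?_ (add_le_add_left h3 _)
    rw [← add_div, inv_eq_one_div]
    gcongr
    linarith
  have h3 := (mp.integrableOn_comp_preimage me (s := Ioi s) (f := fun p => p⁻¹)).1 (by
    rw [hpre]; exact h2)
  exact not_integrableOn_Ioi_inv h3

/-! ### Triviality of the centre -/

/-- A vector of `H(I)` whose distributional derivative vanishes on `I` is zero. -/
theorem eq_zero_of_inner_deriv {β : ℝ} (hβ : 0 < β) {a b : ℝ} (hab : a < b) {x : OneParticle β}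
    (hx : x ∈ localSpace β (Ioo a b))
    (h : ∀ g : testFunctions (Ioo a b), (inner ℂ (Purified.mk x 0)
      (Purified.mk (embed β (Ioo a b) g) 0)).im = 0) : x = 0 := by
  obtain ⟨f, X, hfx, hfX⟩ := exists_tendsto_toLp hβ hx
  -- A subsequence of the `f n` converges almost everywhere to `X`, and all its members vanish off
  -- the interval.
  have hXoff : ∀ᵐ y, y ∉ Ioo a b → X y = 0 := by
    obtain ⟨ns, -, hns⟩ := (tendstoInMeasure_of_tendsto_Lp hfX).exists_seq_tendsto_ae
    filter_upwards [hns, ae_all_iff.2 fun n => (toSchwartz (f n)).coeFn_toLp 2 volume]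
      with y h1 h2 hy
    simp only [h2, toSchwartz_apply] at h1
    have h3 : ∀ n, ((f n : ℝ → ℝ) y : ℂ) = 0 := fun n => by
      rw [image_eq_zero_of_notMem_tsupport fun h => hy ((f n).2.2.2 h), ofReal_zero]
    simp only [h3] at h1
    exact tendsto_nhds_unique h1 tendsto_const_nhds
  -- The numbers `σ(f n, g) = ∫ g' f n` converge to `∫ g' X` by the `L²` limit and to `σ(x, g) = 0`
  -- by the thermal limit.
  have hXd : ∀ g : testFunctions (Ioo a b), ∫ y, ((deriv (g : ℝ → ℝ) y : ℝ) : ℂ) * X y = 0 := by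
    intro g
    have hg1 : Continuous (deriv (g : ℝ → ℝ)) := g.2.1.continuous_deriv (by simp)
    have hk : MemLp (fun y => ((deriv (g : ℝ → ℝ) y : ℝ) : ℂ)) 2 :=
      (Complex.continuous_ofReal.comp hg1).memLp_of_hasCompactSupport
        (g.2.2.1.deriv.comp_left (g := fun r : ℝ => (r : ℂ)) (by simp))
    have h1 := tendsto_integral_mul hfX hk
    have h2 : ∀ n, ∫ y, ((deriv (g : ℝ → ℝ) y : ℝ) : ℂ) * (toSchwartz (f n)).toLp 2 volume y
        = ((inner ℂ (Purified.mk (embed β (Ioo a b) (f n)) 0)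
          (Purified.mk (embed β (Ioo a b) g) 0)).im : ℂ) := by
      intro n
      rw [integral_mul_toLp, im_inner_embed hβ, ← integral_complex_ofReal]
      congr 1
      ext y
      push_cast; ring
    simp only [h2, inner_mk_zero_left] at h1
    simp only [inner_mk_zero_left] at h
    have h3 := (Complex.continuous_ofReal.tendsto _).comp (hfx.inner (𝕜 := ℝ)
      (tendsto_const_nhds (x := opD β (embed β (Ioo a b) g) - opC β (opR β 0))))
    rw [h g, ofReal_zero] at h3
    exact tendsto_nhds_unique h1 h3
  obtain ⟨c, hc⟩ := exists_ae_eq_const ((Lp.memLp X).locallyIntegrable (by norm_num)) hab hXd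
  -- Along a subsequence the transforms of the `f n` converge almost everywhere to `x`. For fixed
  -- `p` they also converge to the integral of `X` against the exponential cut off to the interval,
  -- because this kernel is in `L²`. So `x` is `c` times the transform of the indicator of the
  -- interval.
  have hxval : ∀ᵐ p ∂(thermalMeasure β),
      x p = c * ∫ y in a..b, Complex.exp (I * p * y) := by
    obtain ⟨ns, hns0, hns⟩ := (tendstoInMeasure_of_tendsto_Lp hfx).exists_seq_tendsto_ae
    filter_upwards [hns, ae_all_iff.2 fun n => coeFn_embed β (f n)] with p h1 h2
    simp only [h2] at h1
    set k : ℝ → ℂ := (Ioo a b).indicator fun y => Complex.exp (I * y * p) with hk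
    have hkm : MemLp k 2 := by
      rw [hk, memLp_indicator_iff_restrict measurableSet_Ioo]
      refine MemLp.of_bound (by fun_prop) 1 (ae_of_all _ fun y => ?_)
      rw [mul_assoc, mul_comm, ← ofReal_mul, norm_exp_ofReal_mul_I]
    have h3 := (tendsto_integral_mul hfX hkm).comp hns0.tendsto_atTop
    have h4 : ∀ n, ∫ y, k y * (toSchwartz (f n)).toLp 2 volume y = fourierHat (f n) p := by
      intro n
      rw [integral_mul_toLp]
      unfold fourierHat
      congr 1
      ext y
      by_cases hy : y ∈ Ioo a b
      · rw [hk, indicator_of_mem hy]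
      · rw [image_eq_zero_of_notMem_tsupport fun h => hy ((f n).2.2.2 h)]
        simp
    simp only [Function.comp_def, h4] at h3
    rw [tendsto_nhds_unique h1 h3, intervalIntegral.integral_of_le hab.le, integral_Ioc_eq_integral_Ioo,
      ← integral_const_mul, ← integral_indicator measurableSet_Ioo]
    refine integral_congr_ae ?_
    filter_upwards [hc] with y hy
    by_cases hy' : y ∈ Ioo a b
    · rw [hk, indicator_of_mem hy', indicator_of_mem hy', hy hy', mul_right_comm, mul_comm]
    · rw [hk, indicator_of_notMem hy', indicator_of_notMem hy', zero_mul]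
  by_cases hc0 : c = 0
  · apply Lp.ext
    filter_upwards [hxval, Lp.coeFn_zero ℂ 2 (thermalMeasure β)] with p h1 h2
    rw [h1, h2, hc0, zero_mul]; rfl
  exfalso
  refine not_integrableOn_one_sub_cos_div (sub_pos.2 hab) ?_
  have hpi := Real.pi_pos
  have hcn : 0 < ‖c‖ := norm_pos_iff.2 hc0
  -- The constant cancels the factor `2 ‖c‖²` in `‖x p‖²` and the `1 / π` in the bound `p / π` of
  -- the weight, leaving exactly `(1 - cos ((b - a) p)) / p`.
  refine Integrable.mono' ((norm_sq_eq_integral hβ x).1.const_mul (Real.pi / (2 * ‖c‖ ^ 2)))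
    (by fun_prop : Measurable _).aestronglyMeasurable ?_
  filter_upwards [(absolutelyContinuous_thermalMeasure hβ).2.ae_le hxval,
    ae_restrict_mem measurableSet_Ioi] with p h1 hp
  have hp : 0 < p := hp
  have hIp : I * (p : ℂ) ≠ 0 := mul_ne_zero I_ne_zero (by exact_mod_cast hp.ne')
  have h2 : ‖x p‖ ^ 2 = ‖c‖ ^ 2 * (2 * (1 - Real.cos ((b - a) * p))) / p ^ 2 := by
    have e : ∀ t : ℝ, I * (p : ℂ) * t = ((p * t : ℝ) : ℂ) * I := fun t => by push_cast; ring
    rw [h1, integral_exp_mul_complex hIp, norm_mul, norm_div, norm_mul, norm_I, norm_real,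
      Real.norm_of_nonneg hp.le, one_mul, mul_pow, div_pow, ← mul_div_assoc]
    congr 2
    rw [e, e, Complex.sq_norm, normSq_apply, sub_re, sub_im, exp_ofReal_mul_I_re,
      exp_ofReal_mul_I_re, exp_ofReal_mul_I_im, exp_ofReal_mul_I_im,
      show (b - a) * p = p * b - p * a by ring, Real.cos_sub]
    nlinarith [Real.sin_sq_add_cos_sq (p * a), Real.sin_sq_add_cos_sq (p * b)]
  have h3 : 0 ≤ 1 - Real.cos ((b - a) * p) := by linarith [Real.cos_le_one ((b - a) * p)]
  rw [Real.norm_of_nonneg (div_nonneg h3 hp.le)]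
  calc (1 - Real.cos ((b - a) * p)) / p
      = Real.pi / (2 * ‖c‖ ^ 2) * (p / Real.pi * ‖x p‖ ^ 2) := by rw [h2]; field_simp
    _ ≤ _ := by
      gcongr
      exact (le_thermalWeight hβ hp).1

/-! ### Standardness and factoriality -/

lemma eq_zero_of_opR_eq_zero {β : ℝ} {x : OneParticle β} (h : opR β x = 0) : x = 0 := by
  apply Lp.ext
  have h1 : mulOp β _ (memLp_sech β) x = 0 := h
  filter_upwards [coeFn_mulOp β _ (memLp_sech β) x, Lp.coeFn_zero ℂ 2 (thermalMeasure β)]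
    with p h2 h3
  rw [h1, h3] at h2
  rw [h3]
  refine (mul_eq_zero.1 h2.symm).resolve_left ?_
  exact_mod_cast (thermalSech_pos β p).ne'

lemma mk_mem_localSubspace {β : ℝ} {U : Set ℝ} {x : OneParticle β} (hx : x ∈ localSpace β U) :
    Purified.mk x 0 ∈ localSubspace β U := ⟨x, hx, rfl⟩

lemma embed_mem_localSpace (β : ℝ) {U : Set ℝ} (f : testFunctions U) :
    embed β U f ∈ localSpace β U :=
  Submodule.le_topologicalClosure _ (LinearMap.mem_range_self _ f)

lemma mk_eq_zero {β : ℝ} : Purified.mk (0 : OneParticle β) 0 = 0 := rfl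

/-- `H(U)` is separating. -/
theorem localSubspace_inf_mulI (β : ℝ) (U : Set ℝ) :
    localSubspace β U ⊓ (localSubspace β U).mulI = ⊥ := by
  refine le_antisymm (fun v hv => ?_) bot_le
  obtain ⟨⟨x, -, rfl⟩, h2⟩ := ClosedSubmodule.mem_inf.1 hv
  rw [ClosedSubmodule.mem_mapEquiv_iff, scalarSMulCLE_symm_apply, Units.smul_def,
    Units.val_inv_eq_inv_val, Complex.val_UnitI, inv_I] at h2
  obtain ⟨y, -, hy⟩ := h2
  -- Multiplication by `i^⊕` mixes the two summands through `C √(1 + D²)`; staying in `𝒦 ⊕ 0` forces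
  -- this component to vanish, and `C² = -1` removes the phase.
  have h3 : (Purified.toDoubled ((-I) • Purified.mk x 0)).snd = 0 := by rw [hy]; rfl
  have h4 : (Purified.toDoubled ((-I) • Purified.mk x 0)).snd = -(opC β (opR β x)) := by
    rw [Purified.smul_def]
    change (-I).re • (0 : OneParticle β) + (-I).im • (opC β (opR β x) + opD β 0) = _
    simp
  rw [h4, neg_eq_zero] at h3
  have h5 : opR β x = 0 := by
    rw [← neg_eq_zero, ← opC_opC, h3, map_zero]
  rw [eq_zero_of_opR_eq_zero h5]
  exact ClosedSubmodule.mem_bot.2 mk_eq_zero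

open ClosedSubmodule in
/-- `H(I)` is cyclic. -/
theorem localSubspace_sup_mulI {β : ℝ} (hβ : 0 < β) {a b : ℝ} (hab : a < b) :
    localSubspace β (Ioo a b) ⊔ (localSubspace β (Ioo a b)).mulI = ⊤ := by
  -- Density is turned into triviality of the real orthogonal complement, which is the intersection
  -- of the complement of `H(I)` with its symplectic complement. The two conditions are the
  -- vanishing of the real and of the imaginary part of one complex inner product.
  rw [← orthogonal_orthogonal_eq (localSubspace β (Ioo a b) ⊔ (localSubspace β (Ioo a b)).mulI),
    orthogonal_eq_top_iff, ← inf_orthogonal]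
  refine le_antisymm (fun v hv => ?_) bot_le
  obtain ⟨h1, h2⟩ := ClosedSubmodule.mem_inf.1 hv
  rw [mem_orthogonal] at h1
  have h2 := mem_symplComp_iff.1 h2
  obtain ⟨hx, hy⟩ := eq_zero_of_inner_embed_eq_zero hβ hab (Purified.toDoubled v).fst
    (Purified.toDoubled v).snd fun f =>
      Complex.ext (h1 _ (mk_mem_localSubspace (embed_mem_localSpace β f)))
        (h2 _ (mk_mem_localSubspace (embed_mem_localSpace β f)))
  have hv : v = Purified.mk (Purified.toDoubled v).fst (Purified.toDoubled v).snd := rfl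
  rw [hv, hx, hy]
  exact ClosedSubmodule.mem_bot.2 mk_eq_zero

/-- `H(I)` is factorial. -/
theorem localSubspace_inf_symplComp {β : ℝ} (hβ : 0 < β) {a b : ℝ} (hab : a < b) :
    localSubspace β (Ioo a b) ⊓ (localSubspace β (Ioo a b)).symplComp = ⊥ := by
  refine le_antisymm (fun v hv => ?_) bot_le
  obtain ⟨⟨x, hx, rfl⟩, h2⟩ := ClosedSubmodule.mem_inf.1 hv
  have h2 := ClosedSubmodule.mem_symplComp_iff.1 h2
  have h3 : x = 0 := eq_zero_of_inner_deriv hβ hab hx fun g => by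
    -- Membership in the symplectic complement puts `x` in the second slot; conjugate symmetry of
    -- the inner product moves it to the first.
    rw [← inner_conj_symm, conj_im, h2 _ (mk_mem_localSubspace (embed_mem_localSpace β g)),
      neg_zero]
  rw [h3]
  exact ClosedSubmodule.mem_bot.2 mk_eq_zero

end ThermalCurrent

end

theorem mainTheorem4 (β : ℝ) (hβ : 0 < β) (a b : ℝ) (hab : a < b) :
    (∃ S : StandardSubspace (ThermalCurrent.Purified β),
      S.toClosedSubmodule = ThermalCurrent.localSubspace β (Set.Ioo a b)) ∧
    ThermalCurrent.localSubspace β (Set.Ioo a b) ⊓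
      (ThermalCurrent.localSubspace β (Set.Ioo a b)).symplComp = ⊥ :=
  ⟨⟨⟨_, ThermalCurrent.localSubspace_inf_mulI β _, ThermalCurrent.localSubspace_sup_mulI hβ hab⟩,
    rfl⟩, ThermalCurrent.localSubspace_inf_symplComp hβ hab⟩
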